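/- Let $k$ be a finite field of odd order and let $k\subset\ell$ be a quadratic field extension, with $x\mapsto\overline{x}$ the non-trivial $k$-automorphism of $\ell$. A $k$-algebra is a $k$-vector space with a $k$-bilinear product, not assumed associative or unital; a division algebra is a non-zero algebra in which left and right multiplication by every non-zero element are bijective. Let $\mathscr{C}(k)$ be the class of all $4$-dimensional unital division $k$-algebras $A$ such that $k1_A$ is properly contained in the right nucleus $\{z\in A : (xy)z=x(yz)\ \forall x,y\in A\}$ and such that the group $\mathrm{Aut}(A)$ of $k$-algebra automorphisms of $A$ has a subgroup that is Klein's four-group. Let $\mathscr{N}(k)$ be the class of non-associative algebras in $\mathscr{C}(k)$. For $c=(c_1,c_2,c_3)\in k^3$ let $A(\ell,c)$ be the $k$-vector space $\ell^2$ with product $$(x,y)\cdot(w,z)=\bigl(xw+(c_2y+c_3\overline{y})z,\ yw+((1-c_1)x+c_1\overline{x})z\bigr).$$ The triple $c$ is called $\ell$-admissible if $(x,y)=(0,0)$ is the only zero in $\ell^2$ of $(1-c_1)x^2+c_1x\overline{x}-c_2y^2-c_3y\overline{y}$. Let $C_\ell^{\mathscr{N}}$ be the set of all $\ell$-admissible triples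 $c$ with $A(\ell,c)\in\mathscr{N}(k)$. Triples $c,d\in k^3$ are $\ell^*$-equivalent if there is $a\in\ell\setminus\{0\}$ with $(c_1,\,c_2/a^2,\,c_3/(a\overline{a}))=(d_1,d_2,d_3)$; this is an equivalence relation. A pair $(a,b)\in k^2$ is called $\ell$-admissible if $(x,y)=(0,0)$ is the only zero in $\ell^2$ of $x^2-y^2+ax\overline{x}+by\overline{y}$; let $B_\ell\subset k^2$ be the set of $\ell$-admissible pairs. For $x\in k$ put $|x|=x$ if $x$ is a square in $k$ (including $x=0$), and $|x|=-x$ otherwise. Then the following hold. 1. $B_\ell=\{(a,b)\in k^2 : a=b \text{ and } 1-a^2 \text{ is not a square in } k\}$. 2. $C_\ell^{\mathscr{N}}=\left\{\left(c_1,c_2,\dfrac{-c_1|c_2|}{|1-c_1|}\right)\in k^3 : (1-c_1)c_2\neq 0 \text{ and } 1-2c_1 \text{ is not a square in } k\right\}$. 3. The set $T_\ell^{\mathscr{N}}=\left\{\left(c_1,1,\dfrac{-c_1}{|1-c_1|}\right)\in k^3 : c_1\neq 1 \text{ and } 1-2c_1 \text{ is not a square in } k\right\}$ is a transversal for the $\ell^*$-equivalence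 classes of $C_\ell^{\mathscr{N}}$. 4. The algebras $A(\ell,c)$ with $c\in T_\ell^{\mathscr{N}}$ classify $\mathscr{C}(k)$ up to isomorphism: each of them lies in $\mathscr{C}(k)$, every algebra in $\mathscr{C}(k)$ is isomorphic to one of them, and distinct triples in $T_\ell^{\mathscr{N}}$ give non-isomorphic algebras. 5. $\mathscr{C}(k)=\mathscr{N}(k)$, that is, every algebra in $\mathscr{C}(k)$ is non-associative. -/

import Mathlib

/-! Algebras over a field `k` are vector spaces with a `k`-bilinear product, neither associative
nor unital by convention: a `NonUnitalNonAssocRing` with a compatible `k`-module structure. -/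

universe u v w

section General

/-- A division algebra: non-zero, and all left and right multiplications by non-zero elements
are bijective. -/
def IsDivisionAlg (A : Type*) [NonUnitalNonAssocRing A] : Prop :=
  Nontrivial A ∧ ∀ a : A, a ≠ 0 →
    Function.Bijective (fun x : A => a * x) ∧ Function.Bijective (fun x : A => x * a)

/-- `e` is a (two-sided) unity of `A`. -/
def IsUnity {A : Type*} [NonUnitalNonAssocRing A] (e : A) : Prop :=
  ∀ x : A, e * x = x ∧ x * e = x

/-- The right nucleus `N_r(A)`. -/
def rightNucleus (A : Type*) [NonUnitalNonAssocRing A] : Set A :=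
  {z | ∀ x y : A, (x * y) * z = x * (y * z)}

/-- Associativity of the product of `A`. -/
def IsAssociativeAlg (A : Type*) [NonUnitalNonAssocRing A] : Prop :=
  ∀ x y z : A, (x * y) * z = x * (y * z)

/-- Two `k`-algebras are isomorphic: there is a bijective `k`-linear multiplicative map. -/
def IsoAlg (k A B : Type*) [Field k] [NonUnitalNonAssocRing A] [Module k A]
    [NonUnitalNonAssocRing B] [Module k B] : Prop :=
  ∃ φ : A ≃ₗ[k] B, ∀ x y : A, φ (x * y) = φ x * φ y

/-- The automorphism group of a `k`-algebra `A`, as a subgroup of `GL_k(A)`. -/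
def autGroup (k A : Type*) [Field k] [NonUnitalNonAssocRing A] [Module k A] :
    Subgroup (A ≃ₗ[k] A) where
  carrier := {φ | ∀ x y : A, φ (x * y) = φ x * φ y}
  mul_mem' := by
    intro φ ψ hφ hψ x y
    simp only [LinearEquiv.mul_apply]
    rw [hψ, hφ]
  one_mem' := by
    intro x y
    simp
  inv_mem' := by
    intro φ hφ x y
    apply φ.injective
    rw [hφ]
    simp only [← LinearEquiv.mul_apply, mul_inv_cancel, LinearEquiv.coe_one, id_eq]

/-- Membership in the groupoid `𝒞(k)`: four-dimensional unital division `k`-algebras `A` such that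
`k1` is properly contained in the right nucleus of `A` and the automorphism group of `A` has a
subgroup that is Klein's four-group. -/
structure MemC (k A : Type*) [Field k] [NonUnitalNonAssocRing A] [Module k A]
    [IsScalarTower k A A] [SMulCommClass k A A] : Prop where
  finrank_eq : Module.finrank k A = 4
  division : IsDivisionAlg A
  unital : ∃ e : A, IsUnity e ∧ Set.range (fun r : k => r • e) ⊂ rightNucleus A
  klein : ∃ H : Subgroup (autGroup k A), IsKleinFour H

/-- Membership in `𝒩(k)`, the non-associative algebras in `𝒞(k)`. -/
def MemN (k A : Type*) [Field k] [NonUnitalNonAssocRing A] [Module k A]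
    [IsScalarTower k A A] [SMulCommClass k A A] : Prop :=
  MemC k A ∧ ¬ IsAssociativeAlg A

/-- `T` is a transversal of `C` modulo the equivalence relation `r` (restricted to `C`): it is
a subset of `C` that meets every equivalence class in exactly one element. -/
def IsTransversalOf {X : Type*} (r : Setoid X) (C T : Set X) : Prop :=
  T ⊆ C ∧ ∀ c ∈ C, ∃! t, t ∈ T ∧ r c t

end General

section Quadratic

/-- The conjugation `x ↦ x̄` of a quadratic extension `ℓ / k` in characteristic not 2: the
non-trivial element of the Galois group, which has order two. -/
noncomputable def conj (k ℓ : Type*) [Field k] [Field ℓ] [Algebra k ℓ] : ℓ ≃ₐ[k] ℓ :=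
  Classical.epsilon (fun σ : ℓ ≃ₐ[k] ℓ => σ ≠ 1)

/-- A function `ℓ² → ℓ` is anisotropic if `(0,0)` is its only zero. -/
def AnisotropicFun {ℓ : Type*} [Field ℓ] (f : ℓ × ℓ → ℓ) : Prop :=
  f ⁻¹' {0} = {(0, 0)}

/-- `q_c(x,y) = (1-c₁)x² + c₁ x x̄ - c₂ y² - c₃ y ȳ`, where `c = (c₁,c₂,c₃)`. -/
noncomputable def qFun {k : Type*} (ℓ : Type*) [Field k] [Field ℓ] [Algebra k ℓ]
    (c : k × k × k) (p : ℓ × ℓ) : ℓ :=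
  algebraMap k ℓ (1 - c.1) * p.1 ^ 2 + algebraMap k ℓ c.1 * (p.1 * conj k ℓ p.1)
    - algebraMap k ℓ c.2.1 * p.2 ^ 2 - algebraMap k ℓ c.2.2 * (p.2 * conj k ℓ p.2)

/-- `h_{a,b}(x,y) = x² - y² + a x x̄ + b y ȳ`. -/
noncomputable def hFun {k : Type*} (ℓ : Type*) [Field k] [Field ℓ] [Algebra k ℓ]
    (ab : k × k) (p : ℓ × ℓ) : ℓ :=
  p.1 ^ 2 - p.2 ^ 2 + algebraMap k ℓ ab.1 * (p.1 * conj k ℓ p.1)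
    + algebraMap k ℓ ab.2 * (p.2 * conj k ℓ p.2)

/-- The set `C_ℓ` of `ℓ`-admissible triples. -/
def admissibleTriples (k ℓ : Type*) [Field k] [Field ℓ] [Algebra k ℓ] : Set (k × k × k) :=
  {c | AnisotropicFun (qFun ℓ c)}

/-- The set `B_ℓ` of `ℓ`-admissible pairs. -/
def admissiblePairs (k ℓ : Type*) [Field k] [Field ℓ] [Algebra k ℓ] : Set (k × k) :=
  {ab | AnisotropicFun (hFun ℓ ab)}

/-- The map `|·| : k → k` with `|x| = x` if `x` is a square (0 included) and `|x| = -x` if not. -/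
noncomputable def sqAbs {k : Type*} [Field k] (x : k) : k :=
  open Classical in if IsSquare x then x else -x

/-- The underlying space of the algebra `A(ℓ,c)`: columns `(x,y)` with entries in `ℓ`. -/
@[ext]
structure AlgA {k : Type*} (ℓ : Type*) [Field k] [Field ℓ] [Algebra k ℓ] (c : k × k × k) where
  fst : ℓ
  snd : ℓ

namespace AlgA

variable {k ℓ : Type*} [Field k] [Field ℓ] [Algebra k ℓ] {c : k × k × k}

instance : Zero (AlgA ℓ c) := ⟨⟨0, 0⟩⟩

instance : Add (AlgA ℓ c) := ⟨fun a b => ⟨a.fst + b.fst, a.snd + b.snd⟩⟩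

instance : Neg (AlgA ℓ c) := ⟨fun a => ⟨-a.fst, -a.snd⟩⟩

instance : SMul k (AlgA ℓ c) :=
  ⟨fun r a => ⟨algebraMap k ℓ r * a.fst, algebraMap k ℓ r * a.snd⟩⟩

/-- The product of `A(ℓ,c)`: `(x,y) * (w,z)` is the matrix with rows
`(x, c₂ y + c₃ ȳ)` and `(y, (1-c₁) x + c₁ x̄)`, applied to the column `(w,z)`. -/
noncomputable instance : Mul (AlgA ℓ c) where
  mul a b :=
    ⟨a.fst * b.fst +
      (algebraMap k ℓ c.2.1 * a.snd + algebraMap k ℓ c.2.2 * conj k ℓ a.snd) * b.snd,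
     a.snd * b.fst +
      (algebraMap k ℓ (1 - c.1) * a.fst + algebraMap k ℓ c.1 * conj k ℓ a.fst) * b.snd⟩

theorem mul_fst (a b : AlgA ℓ c) : (a * b).fst = a.fst * b.fst +
    (algebraMap k ℓ c.2.1 * a.snd + algebraMap k ℓ c.2.2 * conj k ℓ a.snd) * b.snd := rfl
theorem mul_snd (a b : AlgA ℓ c) : (a * b).snd = a.snd * b.fst +
    (algebraMap k ℓ (1 - c.1) * a.fst + algebraMap k ℓ c.1 * conj k ℓ a.fst) * b.snd := rfl
theorem add_fst (a b : AlgA ℓ c) : (a + b).fst = a.fst + b.fst := rfl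
theorem add_snd (a b : AlgA ℓ c) : (a + b).snd = a.snd + b.snd := rfl
theorem neg_fst (a : AlgA ℓ c) : (-a).fst = -a.fst := rfl
theorem neg_snd (a : AlgA ℓ c) : (-a).snd = -a.snd := rfl
theorem zero_fst : (0 : AlgA ℓ c).fst = 0 := rfl
theorem zero_snd : (0 : AlgA ℓ c).snd = 0 := rfl
theorem smul_fst (r : k) (a : AlgA ℓ c) : (r • a).fst = algebraMap k ℓ r * a.fst := rfl
theorem smul_snd (r : k) (a : AlgA ℓ c) : (r • a).snd = algebraMap k ℓ r * a.snd := rfl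

noncomputable instance : NonUnitalNonAssocRing (AlgA ℓ c) where
  add_assoc a b d := by ext <;> simp only [add_fst, add_snd] <;> ring
  zero_add a := by ext <;> simp only [add_fst, add_snd, zero_fst, zero_snd] <;> ring
  add_zero a := by ext <;> simp only [add_fst, add_snd, zero_fst, zero_snd] <;> ring
  add_comm a b := by ext <;> simp only [add_fst, add_snd] <;> ring
  neg_add_cancel a := by
    ext <;> simp only [add_fst, add_snd, neg_fst, neg_snd, zero_fst, zero_snd] <;> ring
  nsmul := nsmulRec
  zsmul := zsmulRec
  left_distrib a b d := by ext <;> simp only [mul_fst, mul_snd, add_fst, add_snd] <;> ring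
  right_distrib a b d := by
    ext <;> simp only [mul_fst, mul_snd, add_fst, add_snd, map_add] <;> ring
  zero_mul a := by ext <;> simp only [mul_fst, mul_snd, zero_fst, zero_snd, map_zero] <;> ring
  mul_zero a := by ext <;> simp only [mul_fst, mul_snd, zero_fst, zero_snd] <;> ring

noncomputable instance : Module k (AlgA ℓ c) where
  one_smul a := by ext <;> simp only [smul_fst, smul_snd, map_one] <;> ring
  mul_smul r s a := by ext <;> simp only [smul_fst, smul_snd, map_mul] <;> ring
  smul_zero r := by ext <;> simp only [smul_fst, smul_snd, zero_fst, zero_snd] <;> ring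
  smul_add r a b := by ext <;> simp only [smul_fst, smul_snd, add_fst, add_snd] <;> ring
  add_smul r s a := by ext <;> simp only [smul_fst, smul_snd, add_fst, add_snd, map_add] <;> ring
  zero_smul a := by ext <;> simp only [smul_fst, smul_snd, zero_fst, zero_snd, map_zero] <;> ring

instance : IsScalarTower k (AlgA ℓ c) (AlgA ℓ c) where
  smul_assoc r a b := by
    ext <;> simp only [smul_eq_mul, mul_fst, mul_snd, smul_fst, smul_snd, map_mul,
      AlgEquiv.commutes] <;> ring

instance : SMulCommClass k (AlgA ℓ c) (AlgA ℓ c) where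
  smul_comm r a b := by
    ext <;> simp only [smul_eq_mul, mul_fst, mul_snd, smul_fst, smul_snd] <;> ring

end AlgA

/-- The set `C_ℓ^𝒩` of those `ℓ`-admissible triples `c` for which `A(ℓ,c)` lies in `𝒩(k)`. -/
def admissibleTriplesN (k ℓ : Type*) [Field k] [Field ℓ] [Algebra k ℓ] : Set (k × k × k) :=
  {c | c ∈ admissibleTriples k ℓ ∧ MemN k (AlgA ℓ c)}

/-- The set `ℓ*(c,d)` of all `a ∈ ℓ*` with `(c₁, c₂ / a², c₃ / (a ā)) = (d₁, d₂, d₃)`. -/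
def ellStar {k : Type*} (ℓ : Type*) [Field k] [Field ℓ] [Algebra k ℓ] (c d : k × k × k) : Set ℓ :=
  {a | a ≠ 0 ∧ c.1 = d.1 ∧ algebraMap k ℓ c.2.1 / a ^ 2 = algebraMap k ℓ d.2.1 ∧
    algebraMap k ℓ c.2.2 / (a * conj k ℓ a) = algebraMap k ℓ d.2.2}

/-- `ℓ*`-equivalence of triples: `c ∼ d` if and only if `ℓ*(c,d)` is not empty. -/
def ellEquiv (k ℓ : Type*) [Field k] [Field ℓ] [Algebra k ℓ] : Setoid (k × k × k) where
  r c d := (ellStar ℓ c d).Nonempty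
  iseqv :=
    { refl := fun c => ⟨1, by simp [ellStar]⟩
      symm := by
        rintro c d ⟨a, ha, h₁, h₂, h₃⟩
        have hb : conj k ℓ a ≠ 0 := by simpa using ha
        refine ⟨a⁻¹, inv_ne_zero ha, h₁.symm, ?_, ?_⟩
        · rw [← h₂]
          field_simp
        · rw [← h₃, map_inv₀]
          field_simp
      trans := by
        rintro c d e ⟨a, ha, h₁, h₂, h₃⟩ ⟨b, hb, g₁, g₂, g₃⟩
        refine ⟨a * b, mul_ne_zero ha hb, h₁.trans g₁, ?_, ?_⟩
        · rw [← g₂, ← h₂, div_div, mul_pow]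
        · rw [← g₃, ← h₃, div_div, map_mul, mul_mul_mul_comm] }

/-- The set `T_ℓ^𝒩` of all triples `(c₁, 1, -c₁ / |1-c₁|)` with `c₁ ≠ 1` and `1 - 2c₁` not a
square. -/
def tripleTransversal (k : Type*) [Field k] : Set (k × k × k) :=
  {c | ∃ c₁ : k, c₁ ≠ 1 ∧ ¬ IsSquare (1 - 2 * c₁) ∧ c = (c₁, 1, -c₁ / sqAbs (1 - c₁))}

/-- The algebras `A(ℓ,c)`, where `c` runs through `T`, classify `𝒞(k)`: they lie in `𝒞(k)`, every
algebra in `𝒞(k)` is isomorphic to one of them, and distinct triples in `T` give non-isomorphic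
algebras. -/
structure ClassifiesC (k : Type u) (ℓ : Type v) [Field k] [Field ℓ] [Algebra k ℓ]
    (T : Set (k × k × k)) : Prop where
  mem : ∀ c ∈ T, MemC k (AlgA ℓ c)
  exhaustive : ∀ (A : Type w) [NonUnitalNonAssocRing A] [Module k A] [IsScalarTower k A A]
    [SMulCommClass k A A], MemC k A → ∃ c ∈ T, IsoAlg k A (AlgA ℓ c)
  irredundant : ∀ c ∈ T, ∀ d ∈ T, IsoAlg k (AlgA ℓ c) (AlgA ℓ d) → c = d

end Quadratic

/-! ### Squares, norms and conjugation in a quadratic extension of finite fields -/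

section QuadraticExtension

/-! Write `g x = (1-c₁)x + c₁x̄` and `f y = c₂y + c₃ȳ`. Left multiplication by `(x,y)` in `A(ℓ,c)`
is right `ℓ`-linear with determinant `x·g x - y·f y = q_c(x,y)`, so `A(ℓ,c)` is a division algebra
exactly when `q_c` is anisotropic. For `(1-c₁)c₂ ≠ 0`, elements `α, β` of `ℓ` with `α² = 1-c₁`, `β²
= c₂` have norms `|1-c₁|`, `|c₂|`; replacing `x, y` by `αx, βy` turns `q_c` into `h_{a,b}` with `a =
c₁/|1-c₁|` and `b = -c₃/|c₂|`. If `(1-c₁)c₂ = 0`, surjectivity of the norm supplies a zero of `q_c`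
in the cases where none is evident.

For `h_{a,b}`, the substitution `x = u + rū`, `y = u - rū` yields a zero whenever a certain affine
relation holds between `r + 1/r` and `u/ū + ū/u`. If `a ≠ b`, a counting argument forces that
relation somewhere (`eq_of_anisotropicFun_hFun`). If `a = b`, every non-trivial zero corresponds to
a root in `k` of `ar² + 2r + a`, so `1 - a²` decides. Here `1 - a² = (1-2c₁)/(1-c₁)²`.

Conversely, let `A` lie in `𝒞(k)`. It is not associative: otherwise Wedderburn makes it a finite
field, whose automorphisms over `k` form a cyclic group. Hence its right nucleus has dimension 2 and
is a copy of `ℓ`. Automorphisms preserve the nucleus, and the Klein four-group contains `α ≠ 1`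
trivial on it and `β` conjugating it. A vector `j` with `αj = -j`, `βj = j` gives `A = ℓ ⊕ jℓ`, and
the symmetries under `α` and `β` leave three free parameters in `k`, namely `c`
(`MemC.exists_isoAlg`). Rescaling `j` is `ℓ*`-equivalence and normalizes `c₂` to 1; then
admissibility determines `c₃` from `c₁`, and `c₁` is an isomorphism invariant because the right
nucleus of the algebra is exactly `ℓ` (`AlgA.fst_eq_of_isoAlg`). -/

theorem two_ne_zero_of_odd_card {k : Type*} [Field k] [Finite k] (hk : Odd (Nat.card k)) :
    (2 : k) ≠ 0 := by
  have := Fintype.ofFinite k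
  refine Ring.two_ne_zero fun h => ?_
  rw [FiniteField.even_card_iff_char_two, ← Nat.card_eq_fintype_card] at h
  rcases hk with ⟨m, hm⟩
  omega

theorem ringChar_ne_two {k : Type*} [Field k] (h2 : (2 : k) ≠ 0) : ringChar k ≠ 2 := by
  intro h
  apply h2
  have := ringChar.Nat.cast_ringChar (R := k)
  rw [h] at this
  exact_mod_cast this

theorem isSquare_div_of_not_isSquare {k : Type*} [Field k] [Finite k] (h2 : (2 : k) ≠ 0)
    {x d : k} (hx : ¬ IsSquare x) (hd : ¬ IsSquare d) : IsSquare (x / d) := by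
  classical
  have := Fintype.ofFinite k
  have hx0 : x ≠ 0 := fun h => hx (h ▸ IsSquare.zero)
  have hd0 : d ≠ 0 := fun h => hd (h ▸ IsSquare.zero)
  have hc := ringChar_ne_two h2
  have h1 : ∀ y : k, y ≠ 0 → ¬ IsSquare y → y ^ (Fintype.card k / 2) = -1 := fun y hy hy' =>
    (FiniteField.pow_dichotomy hc hy).resolve_left
      (fun h => hy' ((FiniteField.isSquare_iff hc hy).2 h))
  rw [FiniteField.isSquare_iff hc (div_ne_zero hx0 hd0), div_pow, h1 x hx0 hx, h1 d hd0 hd]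
  simp

/-- `s` is a square root in `ℓ` of a non-square `d` of `k`, generating `ℓ` over `k`. -/
structure IsSqrtGenerator (k ℓ : Type*) [Field k] [Field ℓ] [Algebra k ℓ] (d : k) (s : ℓ) :
    Prop where
  not_isSquare : ¬ IsSquare d
  mul_self : s * s = algebraMap k ℓ d
  conj_eq : conj k ℓ s = -s
  exists_coords : ∀ x : ℓ, ∃ p q : k, x = algebraMap k ℓ p + algebraMap k ℓ q * s

variable {k ℓ : Type*} [Field k] [Field ℓ] [Algebra k ℓ]

/-- Euler's criterion in `ℓ`: with `q = |k|`, the exponent `(q²-1)/2` is a multiple of `q-1`, so it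
kills `k*`. -/
theorem isSquare_algebraMap [Finite k] (hk : Odd (Nat.card k)) (hℓ : Module.finrank k ℓ = 2)
    (x : k) : IsSquare (algebraMap k ℓ x) := by
  have h2 := two_ne_zero_of_odd_card hk
  have h2' : (2 : ℓ) ≠ 0 := by
    rw [← map_ofNat (algebraMap k ℓ) 2]
    exact (map_ne_zero (algebraMap k ℓ)).2 h2
  have : Module.Finite k ℓ := Module.finite_of_finrank_pos (by omega)
  have : Finite ℓ := Module.finite_of_finite k
  have := Fintype.ofFinite k
  have := Fintype.ofFinite ℓ
  rcases eq_or_ne x 0 with rfl | hx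
  · simp
  have hcard : Fintype.card ℓ = Fintype.card k ^ 2 := by
    rw [← hℓ]; exact Module.card_eq_pow_finrank
  rw [FiniteField.isSquare_iff (ringChar_ne_two h2') (by simpa using hx), hcard, ← map_pow]
  obtain ⟨m, hm⟩ := hk
  rw [Nat.card_eq_fintype_card] at hm
  have h1 := FiniteField.pow_card_sub_one_eq_one x hx
  have h3 : Fintype.card k ^ 2 / 2 = (Fintype.card k - 1) * (m + 1) := by
    rw [hm, Nat.add_sub_cancel]
    have : (2 * m + 1) ^ 2 = 2 * (2 * m * (m + 1)) + 1 := by ring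
    omega
  rw [h3, pow_mul, h1]
  simp

theorem conj_ne_one [Finite k] (hℓ : Module.finrank k ℓ = 2) : conj k ℓ ≠ 1 := by
  have : Module.Finite k ℓ := Module.finite_of_finrank_pos (by omega)
  have : Finite ℓ := Module.finite_of_finite k
  refine Classical.epsilon_spec (p := fun σ : ℓ ≃ₐ[k] ℓ => σ ≠ 1) ?_
  by_contra! h
  have h1 := IsGalois.card_aut_eq_finrank k ℓ
  have : Subsingleton (ℓ ≃ₐ[k] ℓ) := ⟨fun a b => by rw [h a, h b]⟩
  rw [hℓ, Nat.card_unique] at h1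
  omega

theorem exists_isSqrtGenerator [Finite k] (hk : Odd (Nat.card k))
    (hℓ : Module.finrank k ℓ = 2) : ∃ (d : k) (s : ℓ), IsSqrtGenerator k ℓ d s := by
  have h2 := two_ne_zero_of_odd_card hk
  obtain ⟨d, hd⟩ := FiniteField.exists_nonsquare (ringChar_ne_two h2)
  obtain ⟨s, hs⟩ := isSquare_algebraMap hk hℓ d
  have hfin : Module.Finite k ℓ := Module.finite_of_finrank_pos (by omega)
  have hcoords : ∀ x : ℓ, ∃ p q : k, x = algebraMap k ℓ p + algebraMap k ℓ q * s := by
    let f : (k × k) →ₗ[k] ℓ :=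
      (Algebra.linearMap k ℓ).comp (LinearMap.fst k k k) +
        ((LinearMap.mulRight k s).comp (Algebra.linearMap k ℓ)).comp (LinearMap.snd k k k)
    have hf : ∀ p, f p = algebraMap k ℓ p.1 + algebraMap k ℓ p.2 * s := fun p => rfl
    have hinj : Function.Injective f := by
      rw [← LinearMap.ker_eq_bot, LinearMap.ker_eq_bot']
      rintro ⟨p, q⟩ h
      rw [hf] at h
      simp only at h
      have hq : q = 0 := by
        by_contra hq
        apply hd
        refine ⟨p / q, (algebraMap k ℓ).injective ?_⟩
        have hq' : algebraMap k ℓ q ≠ 0 := by simpa using hq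
        have hs' : s = -(algebraMap k ℓ p / algebraMap k ℓ q) := by
          field_simp
          linear_combination h
        rw [hs, hs', map_mul, map_div₀]
        ring
      subst hq
      simp at h
      simp [h]
    have hsurj := (LinearMap.injective_iff_surjective_of_finrank_eq_finrank
      (by rw [hℓ]; simp)).1 hinj
    intro x
    obtain ⟨p, hp⟩ := hsurj x
    exact ⟨p.1, p.2, by rw [← hf, hp]⟩
  refine ⟨d, s, hd, hs.symm, ?_, hcoords⟩
  have h1 : conj k ℓ s * conj k ℓ s = s * s := by
    rw [← map_mul, ← hs, AlgEquiv.commutes]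
  rcases mul_self_eq_mul_self_iff.1 h1 with h | h
  · exfalso
    apply conj_ne_one hℓ
    ext x
    obtain ⟨p, q, rfl⟩ := hcoords x
    simp [h]
  · exact h

namespace IsSqrtGenerator

variable {d : k} {s : ℓ}

theorem ne_zero (hs : IsSqrtGenerator k ℓ d s) : s ≠ 0 := by
  rintro rfl
  have := hs.mul_self
  rw [mul_zero, eq_comm, map_eq_zero] at this
  exact hs.not_isSquare (this ▸ IsSquare.zero)

theorem conj_conj (hs : IsSqrtGenerator k ℓ d s) (x : ℓ) : conj k ℓ (conj k ℓ x) = x := by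
  obtain ⟨p, q, rfl⟩ := hs.exists_coords x
  simp [hs.conj_eq]

theorem conj_coords (hs : IsSqrtGenerator k ℓ d s) (p q : k) :
    conj k ℓ (algebraMap k ℓ p + algebraMap k ℓ q * s) =
      algebraMap k ℓ p - algebraMap k ℓ q * s := by
  simp [hs.conj_eq, sub_eq_add_neg]

theorem coords_eq_zero (hs : IsSqrtGenerator k ℓ d s) {p q : k}
    (h : algebraMap k ℓ p + algebraMap k ℓ q * s = 0) : p = 0 ∧ q = 0 := by
  have hq : q = 0 := by
    by_contra hq
    apply hs.not_isSquare
    refine ⟨p / q, (algebraMap k ℓ).injective ?_⟩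
    have hq' : algebraMap k ℓ q ≠ 0 := by simpa using hq
    have hs' : s = -(algebraMap k ℓ p / algebraMap k ℓ q) := by
      field_simp
      linear_combination h
    rw [← hs.mul_self, hs', map_mul, map_div₀]
    ring
  subst hq
  simpa using h

theorem exists_of_conj_eq (hs : IsSqrtGenerator k ℓ d s) (h2 : (2 : k) ≠ 0) {x : ℓ}
    (hx : conj k ℓ x = x) : ∃ p : k, x = algebraMap k ℓ p := by
  obtain ⟨p, q, rfl⟩ := hs.exists_coords x
  rw [hs.conj_coords] at hx
  have : algebraMap k ℓ 0 + algebraMap k ℓ (2 * q) * s = 0 := by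
    simp only [map_mul, map_ofNat, map_zero]
    linear_combination -hx
  have hq : q = 0 := by simpa [h2] using (hs.coords_eq_zero this).2
  exact ⟨p, by simp [hq]⟩

theorem exists_norm (hs : IsSqrtGenerator k ℓ d s) (h2 : (2 : k) ≠ 0) (x : ℓ) :
    ∃ n : k, x * conj k ℓ x = algebraMap k ℓ n :=
  hs.exists_of_conj_eq h2 (by rw [map_mul, hs.conj_conj, mul_comm])

/-- The source of `|·|`: a non-square `x` is `t²d`, with root `ts` of norm `-t²d = -x`, while a
square has a root in `k`, whose norm is `x` itself. -/
theorem exists_sq_eq (hs : IsSqrtGenerator k ℓ d s) [Finite k] (h2 : (2 : k) ≠ 0) (x : k) :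
    ∃ a : ℓ, a ^ 2 = algebraMap k ℓ x ∧ a * conj k ℓ a = algebraMap k ℓ (sqAbs x) := by
  unfold sqAbs
  split_ifs with hx
  · obtain ⟨t, rfl⟩ := hx
    exact ⟨algebraMap k ℓ t, by simp [sq], by simp⟩
  · obtain ⟨t, ht⟩ := isSquare_div_of_not_isSquare h2 hx hs.not_isSquare
    have hd0 : d ≠ 0 := fun h => hs.not_isSquare (h ▸ IsSquare.zero)
    have hx' : x = t * t * d := by rw [← ht]; field_simp
    refine ⟨algebraMap k ℓ t * s, ?_, ?_⟩
    · rw [hx', map_mul, map_mul, ← hs.mul_self]; ring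
    · rw [hx', map_mul, hs.conj_eq, map_neg, AlgEquiv.commutes, map_mul, map_mul, ← hs.mul_self]
      ring

/-- The norm form `p² - dq²` represents every element, by counting the values of two quadratic
polynomials. -/
theorem exists_norm_eq (hs : IsSqrtGenerator k ℓ d s) [Finite k] (h2 : (2 : k) ≠ 0) (x : k) :
    ∃ a : ℓ, a * conj k ℓ a = algebraMap k ℓ x := by
  have := Fintype.ofFinite k
  have hd0 : d ≠ 0 := fun h => hs.not_isSquare (h ▸ IsSquare.zero)
  obtain ⟨p, q, hpq⟩ := FiniteField.exists_root_sum_quadratic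
    (f := Polynomial.X ^ 2 - Polynomial.C x) (g := Polynomial.C (-d) * Polynomial.X ^ 2)
    (Polynomial.degree_X_pow_sub_C (by norm_num) x)
    (Polynomial.degree_C_mul_X_pow 2 (neg_ne_zero.2 hd0))
    (FiniteField.odd_card_of_char_ne_two (ringChar_ne_two h2))
  refine ⟨algebraMap k ℓ p + algebraMap k ℓ q * s, ?_⟩
  simp only [Polynomial.eval_sub, Polynomial.eval_pow, Polynomial.eval_X, Polynomial.eval_C,
    Polynomial.eval_mul] at hpq
  have h := congrArg (algebraMap k ℓ) hpq
  simp only [map_add, map_sub, map_mul, map_pow, map_neg, map_zero, ← hs.mul_self] at h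
  rw [hs.conj_coords]
  linear_combination h

end IsSqrtGenerator
end QuadraticExtension

/-! ### Anisotropy of `h_{a,b}` and `q_c` -/

section Anisotropy

theorem anisotropicFun_iff {ℓ : Type*} [Field ℓ] {f : ℓ × ℓ → ℓ} (h0 : f (0, 0) = 0) :
    AnisotropicFun f ↔ ∀ x y, f (x, y) = 0 → x = 0 ∧ y = 0 := by
  constructor
  · intro h x y hxy
    have : (x, y) ∈ f ⁻¹' {0} := hxy
    rw [h] at this
    simpa using this
  · intro h
    ext ⟨x, y⟩
    constructor
    · intro hxy
      simpa using h x y hxy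
    · intro hxy
      obtain ⟨rfl, rfl⟩ : x = 0 ∧ y = 0 := by simpa using hxy
      exact h0

variable {k ℓ : Type*} [Field k] [Field ℓ] [Algebra k ℓ]

theorem anisotropicFun_hFun_iff {ab : k × k} : AnisotropicFun (hFun ℓ ab) ↔
    ∀ x y : ℓ, x ^ 2 - y ^ 2 + algebraMap k ℓ ab.1 * (x * conj k ℓ x)
      + algebraMap k ℓ ab.2 * (y * conj k ℓ y) = 0 → x = 0 ∧ y = 0 :=
  anisotropicFun_iff (by simp [hFun])

theorem anisotropicFun_qFun_iff {c : k × k × k} : AnisotropicFun (qFun ℓ c) ↔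
    ∀ x y : ℓ, algebraMap k ℓ (1 - c.1) * x ^ 2 + algebraMap k ℓ c.1 * (x * conj k ℓ x)
      - algebraMap k ℓ c.2.1 * y ^ 2 - algebraMap k ℓ c.2.2 * (y * conj k ℓ y) = 0 →
        x = 0 ∧ y = 0 :=
  anisotropicFun_iff (by simp [qFun])

theorem algebraMap_two_ne_zero (h2 : (2 : k) ≠ 0) : (2 : ℓ) ≠ 0 := by
  rw [← map_ofNat (algebraMap k ℓ) 2]
  exact (map_ne_zero (algebraMap k ℓ)).2 h2

namespace IsSqrtGenerator

variable {d : k} {s : ℓ}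

/-- In the coordinates `u = x+y`, `v = x-y`, the equation becomes `2uv + a(uū + vv̄) = 0`. If `u ≠
0`, it makes `v` a `k`-multiple `rū`, and then `ar² + 2r + a = 0`, whose reduced discriminant is `1
- a²`. -/
theorem anisotropicFun_hFun_of_not_isSquare (hs : IsSqrtGenerator k ℓ d s) (h2 : (2 : k) ≠ 0)
    {a : k} (ha : ¬ IsSquare (1 - a ^ 2)) : AnisotropicFun (hFun ℓ (a, a)) := by
  have h2' := algebraMap_two_ne_zero (ℓ := ℓ) h2
  rw [anisotropicFun_hFun_iff]
  intro x y h
  simp only at h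
  have ha0 : a ≠ 0 := by
    rintro rfl
    exact ha ⟨1, by simp⟩
  obtain ⟨u, hu⟩ : ∃ u, u = x + y := ⟨_, rfl⟩
  obtain ⟨v, hv⟩ : ∃ v, v = x - y := ⟨_, rfl⟩
  have hx : 2 * x = u + v := by rw [hu, hv]; ring
  have hy : 2 * y = u - v := by rw [hu, hv]; ring
  have huv : 2 * (u * v) + algebraMap k ℓ a * (u * conj k ℓ u + v * conj k ℓ v) = 0 := by
    rw [hu, hv]
    simp only [map_add, map_sub]
    linear_combination 2 * h
  obtain ⟨m, hm⟩ := hs.exists_norm h2 u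
  obtain ⟨n, hn⟩ := hs.exists_norm h2 v
  have hu0 : u = 0 := by
    by_contra hu0
    have hm0 : algebraMap k ℓ m ≠ 0 := by
      rw [← hm]
      exact mul_ne_zero hu0 (by simpa using hu0)
    have hm0' : m ≠ 0 := by simpa using hm0
    -- This is `v/ū`: multiply `2uv = -a(m+n)` by `ū` and use `uū = m`.
    obtain ⟨r, hr⟩ : ∃ r : k, r = -(a * (m + n)) / (2 * m) := ⟨_, rfl⟩
    have hr' : 2 * m * r = -(a * (m + n)) := by rw [hr]; field_simp
    have hr'' := congrArg (algebraMap k ℓ) hr'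
    simp only [map_mul, map_ofNat, map_neg, map_add] at hr''
    have hvr : v = algebraMap k ℓ r * conj k ℓ u := by
      apply mul_left_cancel₀ (mul_ne_zero h2' hu0)
      rw [hm, hn] at huv
      linear_combination huv - hr'' + 2 * algebraMap k ℓ r * hm * (-1)
    have hn' : n = r ^ 2 * m := by
      apply (algebraMap k ℓ).injective
      rw [← hn, hvr, map_mul, hs.conj_conj, AlgEquiv.commutes, map_mul, map_pow, ← hm]
      ring
    apply ha
    refine ⟨a * r + 1, ?_⟩
    rw [hn'] at hr'
    have : m * (2 * r + a * (1 + r ^ 2)) = 0 := by linear_combination hr'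
    have h3 := (mul_eq_zero.1 this).resolve_left hm0'
    linear_combination (-a) * h3
  have hv0 : v = 0 := by
    rw [hu0] at huv
    simpa [ha0] using huv
  rw [hu0, hv0] at hx hy
  constructor
  · simpa [h2'] using hx
  · simpa [h2'] using hy

/-- At `(u + rū, u - rū)` with `r² + 1 = ρr` and `u² + ū² = τuū`, the value of `h_{a,b}` is `r·uū·(4
+ (a+b)ρ + (a-b)τ)`. The condition on `ρ` provides `r` in `k`; the condition on `τ` provides `u`. -/
theorem exists_isotropic (hs : IsSqrtGenerator k ℓ d s) [Finite k] (h2 : (2 : k) ≠ 0)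
    {a b ρ τ : k} (hρ : IsSquare (ρ ^ 2 - 4)) (hτ : τ = 2 ∨ ¬ IsSquare (τ ^ 2 - 4))
    (h : 4 + (a + b) * ρ + (a - b) * τ = 0) : ¬ AnisotropicFun (hFun ℓ (a, b)) := by
  have h2' := algebraMap_two_ne_zero (ℓ := ℓ) h2
  obtain ⟨r, hr⟩ : ∃ r : k, r ^ 2 + 1 = ρ * r := by
    obtain ⟨t, ht⟩ := hρ
    refine ⟨(ρ + t) / 2, ?_⟩
    field_simp
    linear_combination -ht
  obtain ⟨u, hu0, hu⟩ : ∃ u : ℓ, u ≠ 0 ∧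
      u ^ 2 + conj k ℓ u ^ 2 = algebraMap k ℓ τ * (u * conj k ℓ u) := by
    rcases hτ with rfl | hτ
    · exact ⟨1, one_ne_zero, by simp only [map_one, map_ofNat]; norm_num⟩
    · obtain ⟨t, ht, ht'⟩ := hs.exists_sq_eq h2 (τ ^ 2 - 4)
      rw [sqAbs, if_neg hτ, map_neg, ← ht] at ht'
      have ht0 : t ≠ 0 := by
        rintro rfl
        apply hτ
        have : τ ^ 2 - 4 = 0 := by
          rw [← map_eq_zero (algebraMap k ℓ), ← ht, zero_pow two_ne_zero]
        rw [this]
        exact IsSquare.zero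
      have hct : conj k ℓ t = -t := by
        apply mul_left_cancel₀ ht0
        rw [ht']; ring
      simp only [map_sub, map_pow, map_ofNat] at ht
      -- Hilbert 90: `w = (τ+t)/2` has norm 1 and `w + w̄ = τ`, and `u = 2(1+w)` satisfies `u = wū`.
      refine ⟨2 + algebraMap k ℓ τ + t, ?_, ?_⟩
      · intro h0
        have h1 := congrArg (conj k ℓ) h0
        simp only [map_add, map_ofNat, AlgEquiv.commutes, hct, map_zero] at h1
        have : 2 * t = 0 := by linear_combination h0 - h1
        simp [h2', ht0] at this
      · simp only [map_add, map_ofNat, AlgEquiv.commutes, hct]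
        linear_combination (2 + algebraMap k ℓ τ) * ht
  intro haniso
  rw [anisotropicFun_hFun_iff] at haniso
  have := haniso (u + algebraMap k ℓ r * conj k ℓ u) (u - algebraMap k ℓ r * conj k ℓ u) (by
    have hr' := congrArg (algebraMap k ℓ) hr
    have h' := congrArg (algebraMap k ℓ) h
    simp only [map_add, map_sub, map_mul, map_pow, map_ofNat, map_zero, map_one] at hr' h'
    simp only [map_add, map_sub, map_mul, AlgEquiv.commutes, hs.conj_conj]
    linear_combination (algebraMap k ℓ r * u * conj k ℓ u) * h' +
      (algebraMap k ℓ a + algebraMap k ℓ b) * u * conj k ℓ u * hr' +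
      (algebraMap k ℓ a - algebraMap k ℓ b) * algebraMap k ℓ r * hu)
  apply hu0
  apply mul_left_cancel₀ h2'
  linear_combination this.1 + this.2

/-- If `a ≠ b`, each `ρ` determines a unique `τ` solving the relation of `exists_isotropic`.
Anisotropy would force that `τ` to have `τ² - 4` square and `τ ≠ 2`, so an injective self-map of a
finite set would miss a point. Injectivity needs `a + b ≠ 0`, which holds because `h_{a,b}(1,1) = a
+ b`. -/
theorem eq_of_anisotropicFun_hFun (hs : IsSqrtGenerator k ℓ d s) [Finite k] (h2 : (2 : k) ≠ 0)
    {a b : k} (h : AnisotropicFun (hFun ℓ (a, b))) : a = b := by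
  by_contra hab
  have hab' : a - b ≠ 0 := sub_ne_zero.2 hab
  have hsum : a + b ≠ 0 := by
    intro h0
    have h1 := congrArg (algebraMap k ℓ) h0
    simp only [map_add, map_zero] at h1
    have := anisotropicFun_hFun_iff.1 h 1 1 (by simp only [map_one]; linear_combination h1)
    simp at this
  -- An injective self-map of `{ρ | ρ² - 4 is a square}` that misses the element `2`.
  have hmaps : ∀ ρ : k, IsSquare (ρ ^ 2 - 4) →
      IsSquare ((-(4 + (a + b) * ρ) / (a - b)) ^ 2 - 4) ∧ -(4 + (a + b) * ρ) / (a - b) ≠ 2 := by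
    intro ρ hρ
    by_contra hcon
    refine hs.exists_isotropic h2 (τ := -(4 + (a + b) * ρ) / (a - b)) hρ ?_
      (by field_simp; ring) h
    tauto
  let φ : {ρ : k // IsSquare (ρ ^ 2 - 4)} → {ρ : k // IsSquare (ρ ^ 2 - 4)} :=
    fun ρ => ⟨_, (hmaps ρ.1 ρ.2).1⟩
  have hinj : Function.Injective φ := by
    rintro ⟨ρ, hρ⟩ ⟨ρ', hρ'⟩ heq
    have h1 : -(4 + (a + b) * ρ) / (a - b) = -(4 + (a + b) * ρ') / (a - b) :=
      congrArg Subtype.val heq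
    rw [div_left_inj' hab'] at h1
    apply Subtype.ext
    apply mul_left_cancel₀ hsum
    linear_combination -h1
  obtain ⟨ρ, hρ⟩ := (Finite.injective_iff_surjective.1 hinj) ⟨2, by norm_num⟩
  exact (hmaps ρ.1 ρ.2).2 (congrArg Subtype.val hρ)

theorem anisotropicFun_hFun_iff_not_isSquare (hs : IsSqrtGenerator k ℓ d s) [Finite k]
    (h2 : (2 : k) ≠ 0) (a b : k) :
    AnisotropicFun (hFun ℓ (a, b)) ↔ a = b ∧ ¬ IsSquare (1 - a ^ 2) := by
  have h2' := algebraMap_two_ne_zero (ℓ := ℓ) h2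
  constructor
  · intro h
    obtain rfl := hs.eq_of_anisotropicFun_hFun h2 h
    refine ⟨rfl, ?_⟩
    rintro ⟨t, ht⟩
    rw [anisotropicFun_hFun_iff] at h
    rcases eq_or_ne a 0 with rfl | ha
    · have := h 1 1 (by simp)
      simp at this
    -- A root of `ar² + 2r + a` by the quadratic formula; it gives the zero `(1+r, 1-r)`.
    · obtain ⟨r, hr⟩ : ∃ r : k, a * r = t - 1 := ⟨(t - 1) / a, by field_simp⟩
      have hr1 : 2 * r + a + a * r ^ 2 = 0 := by
        apply mul_left_cancel₀ ha
        linear_combination (a * r + t + 1) * hr - ht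
      have hr2 := congrArg (algebraMap k ℓ) hr1
      simp only [map_add, map_mul, map_ofNat, map_pow, map_zero] at hr2
      have := h (1 + algebraMap k ℓ r) (1 - algebraMap k ℓ r) (by
        simp only [map_add, map_sub, map_one, AlgEquiv.commutes]
        linear_combination 2 * hr2)
      apply h2'
      linear_combination this.1 + this.2
  · rintro ⟨rfl, h⟩
    exact hs.anisotropicFun_hFun_of_not_isSquare h2 h

end IsSqrtGenerator

theorem isSquare_one_sub_sq_div_sqAbs_iff {c : k} (hc : 1 - c ≠ 0) :
    IsSquare (1 - (c / sqAbs (1 - c)) ^ 2) ↔ IsSquare (1 - 2 * c) := by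
  have habs : sqAbs (1 - c) ^ 2 = (1 - c) ^ 2 := by
    unfold sqAbs; split_ifs <;> ring
  have h1 : 1 - (c / sqAbs (1 - c)) ^ 2 = (1 - 2 * c) / (1 - c) ^ 2 := by
    rw [div_pow, habs]; field_simp; ring
  rw [h1]
  constructor
  · rintro ⟨t, ht⟩
    refine ⟨t * (1 - c), ?_⟩
    field_simp at ht
    linear_combination ht
  · rintro ⟨t, ht⟩
    exact ⟨t / (1 - c), by rw [ht]; field_simp⟩

theorem sqAbs_ne_zero {x : k} (hx : x ≠ 0) : sqAbs x ≠ 0 := by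
  unfold sqAbs; split_ifs <;> simpa

/-- The square roots `α`, `β` of `1-c₁`, `c₂` absorb the coefficients of the pure squares, while the
norm coefficients are divided by the norms of `α` and `β`. -/
theorem IsSqrtGenerator.anisotropicFun_qFun_iff_hFun {d : k} {s : ℓ}
    (hs : IsSqrtGenerator k ℓ d s) [Finite k] (h2 : (2 : k) ≠ 0) {c : k × k × k}
    (h1 : 1 - c.1 ≠ 0) (hc2 : c.2.1 ≠ 0) : AnisotropicFun (qFun ℓ c) ↔
      AnisotropicFun (hFun ℓ (c.1 / sqAbs (1 - c.1), -c.2.2 / sqAbs c.2.1)) := by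
  obtain ⟨α, hα, hα'⟩ := hs.exists_sq_eq h2 (1 - c.1)
  obtain ⟨β, hβ, hβ'⟩ := hs.exists_sq_eq h2 c.2.1
  have hα0 : α ≠ 0 := by
    rintro rfl
    exact h1 ((map_eq_zero (algebraMap k ℓ)).1 (by rw [← hα, zero_pow two_ne_zero]))
  have hβ0 : β ≠ 0 := by
    rintro rfl
    exact hc2 ((map_eq_zero (algebraMap k ℓ)).1 (by rw [← hβ, zero_pow two_ne_zero]))
  have hαc : conj k ℓ α ≠ 0 := by simpa using hα0
  have hβc : conj k ℓ β ≠ 0 := by simpa using hβ0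
  have key : ∀ x y : ℓ, qFun ℓ c (x, y) =
      hFun ℓ (c.1 / sqAbs (1 - c.1), -c.2.2 / sqAbs c.2.1) (α * x, β * y) := by
    intro x y
    simp only [qFun, hFun, ← hα, ← hβ, map_div₀, ← hα', ← hβ', map_mul, map_neg]
    field_simp
    ring
  rw [anisotropicFun_iff (by simp [qFun]), anisotropicFun_iff (by simp [hFun])]
  constructor
  · intro h x y hxy
    have := h (x / α) (y / β) (by rw [key, mul_div_cancel₀ _ hα0, mul_div_cancel₀ _ hβ0, hxy])
    simpa [hα0, hβ0] using this
  · intro h x y hxy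
    rw [key] at hxy
    simpa [hα0, hβ0] using h _ _ hxy

theorem IsSqrtGenerator.anisotropicFun_qFun_iff_not_isSquare {d : k} {s : ℓ}
    (hs : IsSqrtGenerator k ℓ d s) [Finite k] (h2 : (2 : k) ≠ 0) (c : k × k × k) :
    AnisotropicFun (qFun ℓ c) ↔ (1 - c.1) * c.2.1 ≠ 0 ∧ ¬ IsSquare (1 - 2 * c.1) ∧
        c.2.2 = -c.1 * sqAbs c.2.1 / sqAbs (1 - c.1) := by
  by_cases h1 : (1 - c.1) * c.2.1 = 0
  · simp only [h1, ne_eq, not_true_eq_false, false_and, iff_false]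
    rw [anisotropicFun_qFun_iff]
    intro h
    rcases mul_eq_zero.1 h1 with h1 | h1
    · have hc : c.1 = 1 := by linear_combination -h1
      -- With `c₁ = 1`, `q_c(x,1) = xx̄ - (c₂+c₃)`, so surjectivity of the norm gives a zero.
      obtain ⟨x, hx⟩ := hs.exists_norm_eq h2 (c.2.1 + c.2.2)
      have := h x 1 (by rw [hc]; simp [hx])
      simp at this
    · rcases eq_or_ne c.2.2 0 with h3 | h3
      · have := h 0 1 (by simp [h1, h3])
        simp at this
      -- With `c₂ = 0`, `q_c(1,y) = 1 - c₃yȳ`.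
      · obtain ⟨y, hy⟩ := hs.exists_norm_eq h2 (1 / c.2.2)
        have := h 1 y (by
          rw [hy, ← map_mul, h1]
          simp [h3])
        simp at this
  · obtain ⟨h1', hc2⟩ := mul_ne_zero_iff.1 h1
    have e1 := sqAbs_ne_zero h1'
    have e2 := sqAbs_ne_zero hc2
    rw [hs.anisotropicFun_qFun_iff_hFun h2 h1' hc2, hs.anisotropicFun_hFun_iff_not_isSquare h2,
      isSquare_one_sub_sq_div_sqAbs_iff h1', and_comm]
    simp only [ne_eq, h1, not_false_eq_true, true_and]
    refine and_congr_right fun _ => ?_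
    rw [div_eq_div_iff e1 e2, eq_div_iff e1]
    constructor <;> intro h <;> linear_combination h

end Anisotropy

/-! ### Division algebras, Klein four-groups and isomorphisms -/

section General

theorem isDivisionAlg_of_mul_ne_zero (k : Type*) {A : Type*} [Field k] [NonUnitalNonAssocRing A]
    [Module k A] [IsScalarTower k A A] [SMulCommClass k A A] [Module.Finite k A] [Nontrivial A]
    (h : ∀ a b : A, a ≠ 0 → b ≠ 0 → a * b ≠ 0) : IsDivisionAlg A := by
  refine ⟨inferInstance, fun a ha => ⟨?_, ?_⟩⟩
  · have hinj : Function.Injective (LinearMap.mulLeft k a) := by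
      rw [← LinearMap.ker_eq_bot, LinearMap.ker_eq_bot']
      intro b hb
      by_contra hb0
      exact h a b ha hb0 hb
    exact ⟨hinj, LinearMap.surjective_of_injective hinj⟩
  · have hinj : Function.Injective (LinearMap.mulRight k a) := by
      rw [← LinearMap.ker_eq_bot, LinearMap.ker_eq_bot']
      intro b hb
      by_contra hb0
      exact h b a hb0 ha hb
    exact ⟨hinj, LinearMap.surjective_of_injective hinj⟩

theorem IsDivisionAlg.mul_ne_zero {A : Type*} [NonUnitalNonAssocRing A] (h : IsDivisionAlg A)
    {a b : A} (ha : a ≠ 0) (hb : b ≠ 0) : a * b ≠ 0 := by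
  intro hab
  exact hb ((h.2 a ha).1.1 (by simpa using hab))

theorem exists_isKleinFour {G : Type*} [Group G] {f g : G} (hf : f * f = 1) (hg : g * g = 1)
    (hfg : f * g = g * f) (hf1 : f ≠ 1) (hg1 : g ≠ 1) (hne : f ≠ g) :
    ∃ H : Subgroup G, IsKleinFour H := by
  have hff : ∀ x, f * (f * x) = x := fun x => by rw [← mul_assoc, hf, one_mul]
  have hgf : ∀ x, g * (f * x) = f * (g * x) := fun x => by rw [← mul_assoc, ← hfg, mul_assoc]
  have hsq : ∀ x ∈ ({1, f, g, f * g} : Set G), x * x = 1 := by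
    rintro x (rfl | rfl | rfl | rfl)
    · simp
    · exact hf
    · exact hg
    · simp only [mul_assoc, hgf, hff, hg]
  let H : Subgroup G :=
    { carrier := {1, f, g, f * g}
      one_mem' := by simp
      mul_mem' := by
        rintro x y (rfl | rfl | rfl | rfl) (rfl | rfl | rfl | rfl) <;>
          simp [mul_assoc, hff, hgf, hf, hg, ← hfg]
      inv_mem' := by
        intro x hx
        rw [inv_eq_of_mul_eq_one_right (hsq x hx)]
        exact hx }
  have hcard : Nat.card H = 4 := by
    change Nat.card ({1, f, g, f * g} : Set G) = 4
    classical
    have h1 : f * g ≠ 1 := fun h => hne (by rw [← hff g, h, mul_one])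
    have h2 : f * g ≠ f := fun h => hg1 (by simpa using h)
    have h3 : f * g ≠ g := fun h => hf1 (by simpa using h)
    rw [Nat.card_coe_set_eq, Set.ncard_insert_of_notMem, Set.ncard_insert_of_notMem,
      Set.ncard_pair h3.symm]
    · simp [hne, h2.symm]
    · simp [hf1.symm, hg1.symm, h1.symm]
  refine ⟨H, hcard, ?_⟩
  have hdvd : Monoid.exponent H ∣ 2 := Monoid.exponent_dvd_of_forall_pow_eq_one fun x => by
    apply Subtype.ext
    simpa [sq] using hsq x.1 x.2
  rcases (Nat.dvd_prime Nat.prime_two).1 hdvd with h | h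
  · have := Monoid.exp_eq_one_iff.1 h
    rw [Nat.card_unique] at hcard
    omega
  · exact h

theorem mul_mem_rightNucleus_iff {A B : Type*} [NonUnitalNonAssocRing A]
    [NonUnitalNonAssocRing B] (φ : A ≃ B) (hφ : ∀ x y, φ (x * y) = φ x * φ y) (z : A) :
    φ z ∈ rightNucleus B ↔ z ∈ rightNucleus A := by
  constructor
  · intro h x y
    apply φ.injective
    simp only [hφ]
    exact h _ _
  · intro h x y
    obtain ⟨x, rfl⟩ := φ.surjective x
    obtain ⟨y, rfl⟩ := φ.surjective y
    simp only [← hφ, h x y]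

theorem IsoAlg.trans {k A B C : Type*} [Field k] [NonUnitalNonAssocRing A] [Module k A]
    [NonUnitalNonAssocRing B] [Module k B] [NonUnitalNonAssocRing C] [Module k C]
    (h : IsoAlg k A B) (h' : IsoAlg k B C) : IsoAlg k A C := by
  obtain ⟨φ, hφ⟩ := h
  obtain ⟨ψ, hψ⟩ := h'
  exact ⟨φ.trans ψ, fun x y => by simp [hφ, hψ]⟩

theorem IsoAlg.symm {k A B : Type*} [Field k] [NonUnitalNonAssocRing A] [Module k A]
    [NonUnitalNonAssocRing B] [Module k B] (h : IsoAlg k A B) : IsoAlg k B A := by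
  obtain ⟨φ, hφ⟩ := h
  exact ⟨φ.symm, fun x y => φ.injective (by simp [hφ])⟩

end General

/-! ### The algebras `A(ℓ,c)`: membership in `𝒞(k)`, right nucleus, isomorphisms -/

namespace AlgA

variable {k ℓ : Type*} [Field k] [Field ℓ] [Algebra k ℓ] {c : k × k × k}

/-- The coordinates of an element of `A(ℓ,c)`. -/
def toProd (k ℓ : Type*) [Field k] [Field ℓ] [Algebra k ℓ] (c : k × k × k) :
    AlgA ℓ c ≃ₗ[k] ℓ × ℓ where
  toFun a := (a.fst, a.snd)
  invFun p := ⟨p.1, p.2⟩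
  map_add' _ _ := rfl
  map_smul' r a := by
    ext <;> simp [smul_fst, smul_snd, Algebra.smul_def]
  left_inv _ := rfl
  right_inv _ := rfl

theorem finrank_eq (hℓ : Module.finrank k ℓ = 2) : Module.finrank k (AlgA ℓ c) = 4 := by
  have : Module.Finite k ℓ := Module.finite_of_finrank_pos (by omega)
  rw [(toProd k ℓ c).finrank_eq, Module.finrank_prod, hℓ]

/-- Cramer's rule: `q_c` is the determinant of left multiplication. -/
theorem mul_ne_zero_of_anisotropicFun (h : AnisotropicFun (qFun ℓ c)) {a b : AlgA ℓ c}
    (ha : a ≠ 0) (hb : b ≠ 0) : a * b ≠ 0 := by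
  intro hab
  rw [anisotropicFun_qFun_iff] at h
  have h1 := congrArg fst hab
  have h2 := congrArg snd hab
  simp only [mul_fst, mul_snd, zero_fst, zero_snd] at h1 h2
  by_cases hq : qFun ℓ c (a.fst, a.snd) = 0
  · obtain ⟨h3, h4⟩ := h _ _ hq
    exact ha (AlgA.ext h3 h4)
  · apply hb
    simp only [qFun] at hq
    apply AlgA.ext
    · apply mul_left_cancel₀ hq
      rw [zero_fst]
      linear_combination
        (algebraMap k ℓ (1 - c.1) * a.fst + algebraMap k ℓ c.1 * conj k ℓ a.fst) * h1 -
        (algebraMap k ℓ c.2.1 * a.snd + algebraMap k ℓ c.2.2 * conj k ℓ a.snd) * h2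
    · apply mul_left_cancel₀ hq
      rw [zero_snd]
      linear_combination a.fst * h2 - a.snd * h1

/-- At a zero of `q_c` the multiplication matrix is singular, and the columns of its adjugate lie in
the kernel. -/
theorem anisotropicFun_of_isDivisionAlg (h : IsDivisionAlg (AlgA ℓ c)) :
    AnisotropicFun (qFun ℓ c) := by
  rw [anisotropicFun_qFun_iff]
  intro x y hxy
  by_contra hne
  have ha : (⟨x, y⟩ : AlgA ℓ c) ≠ 0 := fun h0 =>
    hne ⟨congrArg fst h0, congrArg snd h0⟩
  have key : ∀ w z, x * w + (algebraMap k ℓ c.2.1 * y + algebraMap k ℓ c.2.2 * conj k ℓ y) * z = 0 →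
      y * w + (algebraMap k ℓ (1 - c.1) * x + algebraMap k ℓ c.1 * conj k ℓ x) * z = 0 →
      w = 0 ∧ z = 0 := by
    intro w z h1 h2
    have : (⟨w, z⟩ : AlgA ℓ c) = 0 := by
      by_contra hb
      exact h.mul_ne_zero ha hb (AlgA.ext h1 h2)
    exact ⟨congrArg fst this, congrArg snd this⟩
  have h1 := key (algebraMap k ℓ (1 - c.1) * x + algebraMap k ℓ c.1 * conj k ℓ x) (-y)
    (by linear_combination hxy) (by ring)
  have h2 := key (-(algebraMap k ℓ c.2.1 * y + algebraMap k ℓ c.2.2 * conj k ℓ y)) x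
    (by ring) (by linear_combination hxy)
  exact hne ⟨h2.2, by simpa using h1.2⟩

theorem isUnity_one : IsUnity (⟨1, 0⟩ : AlgA ℓ c) := by
  intro x
  constructor <;> ext <;> simp [mul_fst, mul_snd]

theorem mem_rightNucleus (w : ℓ) : (⟨w, 0⟩ : AlgA ℓ c) ∈ rightNucleus (AlgA ℓ c) := by
  intro x y
  ext <;> simp only [mul_fst, mul_snd] <;> ring

/-- On second coordinates, nuclearity tested on `(s,0),(s,0)` compares the scalar `g(s²) = d` with
`g(s)² = (1-2c₁)²d`; their difference `4dc₁(1-c₁)` is non-zero. With `mem_rightNucleus` this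
identifies the right nucleus with `ℓ`. -/
theorem snd_eq_zero_of_mem_rightNucleus {d : k} {s : ℓ} (hs : IsSqrtGenerator k ℓ d s)
    (h2 : (2 : k) ≠ 0) (hc : c.1 ≠ 1) (hsq : ¬ IsSquare (1 - 2 * c.1)) {z : AlgA ℓ c}
    (hz : z ∈ rightNucleus (AlgA ℓ c)) : z.snd = 0 := by
  have hd0 : d ≠ 0 := fun h => hs.not_isSquare (h ▸ IsSquare.zero)
  have hc0 : c.1 ≠ 0 := fun h => hsq ⟨1, by rw [h]; ring⟩
  have h := congrArg snd (hz ⟨s, 0⟩ ⟨s, 0⟩)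
  simp only [mul_snd, mul_fst, hs.conj_eq, map_add, map_mul, map_zero, map_sub, map_one] at h
  have hne : algebraMap k ℓ (4 * d * c.1 * (1 - c.1)) ≠ 0 := by
    have h4 : (4 : k) ≠ 0 := by
      have : (4 : k) = 2 * 2 := by norm_num
      rw [this]; exact mul_ne_zero h2 h2
    have := sub_ne_zero.2 hc.symm
    rw [Ne, map_eq_zero]
    positivity
  apply mul_left_cancel₀ hne
  simp only [map_mul, map_sub, map_one, map_ofNat, ← hs.mul_self]
  linear_combination h

/-- The automorphism `(x,y) ↦ (x,-y)` of `A(ℓ,c)`. -/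
def negSnd (k ℓ : Type*) [Field k] [Field ℓ] [Algebra k ℓ] (c : k × k × k) :
    AlgA ℓ c ≃ₗ[k] AlgA ℓ c where
  toFun a := ⟨a.fst, -a.snd⟩
  invFun a := ⟨a.fst, -a.snd⟩
  map_add' a b := by ext <;> simp [add_fst, add_snd, add_comm]
  map_smul' r a := by ext <;> simp [smul_fst, smul_snd]
  left_inv a := by simp
  right_inv a := by simp

/-- The automorphism `(x,y) ↦ (x̄,ȳ)` of `A(ℓ,c)`. -/
noncomputable def conjBoth {d : k} {s : ℓ} (hs : IsSqrtGenerator k ℓ d s) (c : k × k × k) :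
    AlgA ℓ c ≃ₗ[k] AlgA ℓ c where
  toFun a := ⟨conj k ℓ a.fst, conj k ℓ a.snd⟩
  invFun a := ⟨conj k ℓ a.fst, conj k ℓ a.snd⟩
  map_add' a b := by ext <;> simp [add_fst, add_snd]
  map_smul' r a := by ext <;> simp [smul_fst, smul_snd]
  left_inv a := by simp [hs.conj_conj]
  right_inv a := by simp [hs.conj_conj]

theorem exists_isKleinFour_autGroup {d : k} {s : ℓ} (hs : IsSqrtGenerator k ℓ d s)
    (h2 : (2 : k) ≠ 0) : ∃ H : Subgroup (autGroup k (AlgA ℓ c)), IsKleinFour H := by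
  have h2' := algebraMap_two_ne_zero (ℓ := ℓ) h2
  have h1 : (-1 : ℓ) ≠ 1 := by
    intro h
    apply h2'
    linear_combination -h
  have hs0 : -s ≠ s := by
    intro h
    have : 2 * s = 0 := by linear_combination -h
    simp [h2', hs.ne_zero] at this
  let f : autGroup k (AlgA ℓ c) := ⟨negSnd k ℓ c, fun x y => by
    ext <;> simp [negSnd, mul_fst, mul_snd] <;> ring⟩
  let g : autGroup k (AlgA ℓ c) := ⟨conjBoth hs c, fun x y => by
    ext <;> simp [conjBoth, mul_fst, mul_snd]⟩
  have hf : ∀ a, (f : AlgA ℓ c ≃ₗ[k] AlgA ℓ c) a = ⟨a.fst, -a.snd⟩ := fun a => rfl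
  have hg : ∀ a, (g : AlgA ℓ c ≃ₗ[k] AlgA ℓ c) a = ⟨conj k ℓ a.fst, conj k ℓ a.snd⟩ :=
    fun a => rfl
  refine exists_isKleinFour (f := f) (g := g) ?_ ?_ ?_ ?_ ?_ ?_
  · apply Subtype.ext
    ext a <;> simp [hf]
  · apply Subtype.ext
    ext a <;> simp [hg, hs.conj_conj]
  · apply Subtype.ext
    ext a <;> simp [hf, hg]
  · intro h
    have := congrArg snd (congrArg (fun t : autGroup k (AlgA ℓ c) =>
      (t : AlgA ℓ c ≃ₗ[k] AlgA ℓ c) ⟨0, 1⟩) h)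
    simp [hf, h1] at this
  · intro h
    have := congrArg fst (congrArg (fun t : autGroup k (AlgA ℓ c) =>
      (t : AlgA ℓ c ≃ₗ[k] AlgA ℓ c) ⟨s, 0⟩) h)
    simp [hg, hs.conj_eq, hs0] at this
  · intro h
    have := congrArg snd (congrArg (fun t : autGroup k (AlgA ℓ c) =>
      (t : AlgA ℓ c ≃ₗ[k] AlgA ℓ c) ⟨0, 1⟩) h)
    simp [hf, hg, h1] at this

theorem memC_of_anisotropicFun {d : k} {s : ℓ} (hs : IsSqrtGenerator k ℓ d s)
    (h2 : (2 : k) ≠ 0) (hℓ : Module.finrank k ℓ = 2) (h : AnisotropicFun (qFun ℓ c)) :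
    MemC k (AlgA ℓ c) := by
  have hfin : Module.Finite k (AlgA ℓ c) :=
    Module.finite_of_finrank_pos (by rw [finrank_eq hℓ]; norm_num)
  have : Nontrivial (AlgA ℓ c) := ⟨⟨1, 0⟩, 0, fun h => one_ne_zero (congrArg fst h)⟩
  refine ⟨finrank_eq hℓ, isDivisionAlg_of_mul_ne_zero k fun a b =>
    mul_ne_zero_of_anisotropicFun h, ⟨_, isUnity_one, ?_, ?_⟩, exists_isKleinFour_autGroup hs h2⟩
  · rintro _ ⟨r, rfl⟩
    have : r • (⟨1, 0⟩ : AlgA ℓ c) = ⟨algebraMap k ℓ r, 0⟩ := by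
      ext <;> simp [smul_fst, smul_snd]
    simp only [this]
    exact mem_rightNucleus _
  · intro hsub
    obtain ⟨r, hr⟩ := hsub (mem_rightNucleus s)
    have h3 := congrArg fst hr
    simp only [smul_fst, mul_one] at h3
    have := (hs.coords_eq_zero (p := r) (q := -1) (by rw [h3]; simp)).2
    simp at this

theorem not_isAssociativeAlg {d : k} {s : ℓ} (hs : IsSqrtGenerator k ℓ d s)
    (h2 : (2 : k) ≠ 0) (hc : c.1 ≠ 1) (hsq : ¬ IsSquare (1 - 2 * c.1)) :
    ¬ IsAssociativeAlg (AlgA ℓ c) := by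
  intro h
  exact one_ne_zero (snd_eq_zero_of_mem_rightNucleus hs h2 hc hsq (z := (⟨0, 1⟩ : AlgA ℓ c))
    (fun x y => h x y _))

/-- The map `(x,y) ↦ (x,ay)` transports the product: `c₁` is untouched, and the other two parameters
scale by `a²` and `aā`. -/
theorem isoAlg_of_ellEquiv {c c' : k × k × k} (h : ellEquiv k ℓ c c') :
    IsoAlg k (AlgA ℓ c) (AlgA ℓ c') := by
  obtain ⟨a, ha, h1, h3, h4⟩ := h
  have hac : conj k ℓ a ≠ 0 := by simpa using ha
  rw [div_eq_iff (by positivity)] at h3 h4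
  refine ⟨
    { toFun := fun x => ⟨x.fst, a * x.snd⟩
      invFun := fun x => ⟨x.fst, a⁻¹ * x.snd⟩
      map_add' := fun x y => by ext <;> simp [add_fst, add_snd, mul_add]
      map_smul' := fun r x => by
        ext <;> simp only [smul_fst, smul_snd, RingHom.id_apply]
        ring
      left_inv := fun x => by ext <;> simp [ha]
      right_inv := fun x => by ext <;> simp [ha] }, fun x y => ?_⟩
  ext
  · simp [mul_fst, h3, h4]
    ring
  · simp [mul_snd, h1]
    ring

/-- An isomorphism preserves the right nucleus `ℓ` and sends `s` to a root of `d` there, that is, to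
`±s`. The commutation factor `1-2c₁` in `s·(0,1) = (1-2c₁)(0,1)·s` can then be read off the second
coordinates in the target. -/
theorem fst_eq_of_isoAlg {d : k} {s : ℓ} (hs : IsSqrtGenerator k ℓ d s)
    (h2 : (2 : k) ≠ 0) {c c' : k × k × k} (hc : c.1 ≠ 1) (hsq : ¬ IsSquare (1 - 2 * c.1))
    (hc' : c'.1 ≠ 1) (hsq' : ¬ IsSquare (1 - 2 * c'.1))
    (h : IsoAlg k (AlgA ℓ c) (AlgA ℓ c')) : c.1 = c'.1 := by
  have h2' := algebraMap_two_ne_zero (ℓ := ℓ) h2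
  obtain ⟨φ, hφ⟩ := h
  have hnuc := mul_mem_rightNucleus_iff φ.toEquiv hφ
  have hs1 : (φ ⟨s, 0⟩).snd = 0 :=
    snd_eq_zero_of_mem_rightNucleus hs h2 hc' hsq' ((hnuc _).2 (mem_rightNucleus s))
  have hr : (φ ⟨0, 1⟩).snd ≠ 0 := by
    intro h0
    have hmem : φ ⟨0, 1⟩ ∈ rightNucleus (AlgA ℓ c') := by
      have := mem_rightNucleus (c := c') (φ ⟨0, 1⟩).fst
      have heq : (⟨(φ ⟨0, 1⟩).fst, 0⟩ : AlgA ℓ c') = φ ⟨0, 1⟩ := AlgA.ext rfl h0.symm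
      rwa [heq] at this
    exact one_ne_zero (snd_eq_zero_of_mem_rightNucleus hs h2 hc hsq ((hnuc _).1 hmem))
  have hsquare : φ ⟨s, 0⟩ * φ ⟨s, 0⟩ = φ (d • ⟨1, 0⟩) := by
    rw [← hφ]
    congr 1
    ext <;> simp [mul_fst, mul_snd, smul_fst, smul_snd, hs.mul_self]
  have hone : φ ⟨1, 0⟩ = ⟨1, 0⟩ := by
    obtain ⟨y, hy⟩ := φ.surjective ⟨1, 0⟩
    have h3 := (isUnity_one (φ ⟨1, 0⟩)).1
    rw [← hy, ← hφ, (isUnity_one (c := c) y).2] at h3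
    rw [← h3, hy]
  have hθ : (φ ⟨s, 0⟩).fst * (φ ⟨s, 0⟩).fst = s * s := by
    have := congrArg fst hsquare
    simpa [hone, mul_fst, hs1, smul_fst, hs.mul_self] using this
  have hθ0 : (φ ⟨s, 0⟩).fst ≠ 0 := by
    intro h0
    rw [h0, zero_mul] at hθ
    exact mul_ne_zero hs.ne_zero hs.ne_zero hθ.symm
  have hθc : conj k ℓ (φ ⟨s, 0⟩).fst = -(φ ⟨s, 0⟩).fst := by
    rcases mul_self_eq_mul_self_iff.1 hθ with h | h <;> simp [h, hs.conj_eq]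
  have hrel : (⟨s, 0⟩ : AlgA ℓ c) * ⟨0, 1⟩ = (1 - 2 * c.1) • ((⟨0, 1⟩ : AlgA ℓ c) * ⟨s, 0⟩) := by
    ext
    · simp [mul_fst, smul_fst]
    · simp [mul_snd, smul_snd, hs.conj_eq, map_ofNat]
      ring
  have hrel' := congrArg snd (congrArg φ hrel)
  rw [map_smul, hφ, hφ, mul_snd, smul_snd, mul_snd, hs1, hθc] at hrel'
  apply (algebraMap k ℓ).injective
  simp only [map_sub, map_mul, map_one, map_ofNat] at hrel'
  apply mul_left_cancel₀ (mul_ne_zero h2' (mul_ne_zero hr hθ0))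
  linear_combination hrel'

end AlgA

/-! ### Exclusion of the associative case -/

section FieldCase

/-- The Galois group of a finite field is cyclic, hence so are its subgroups. A bijective
multiplicative linear map fixes 1 by cancellation, so it is a genuine field automorphism. -/
theorem not_isKleinFour_of_field (k F : Type*) [Field k] [Field F] [Algebra k F] [Finite F]
    (H : Subgroup (autGroup k F)) : ¬ IsKleinFour H := by
  intro hH
  let ψ : autGroup k F →* (F ≃ₐ[k] F) :=
    { toFun := fun φ => AlgEquiv.ofLinearEquiv φ.1
        (by
          have h := φ.2 1 1
          rw [mul_one] at h
          have h1 : φ.1 1 ≠ 0 := by simp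
          exact mul_left_cancel₀ h1 (by rw [← h, mul_one])) φ.2
      map_one' := by ext; rfl
      map_mul' := fun a b => by ext; rfl }
  have hinj : Function.Injective (ψ.comp H.subtype) := by
    intro a b hab
    apply Subtype.ext
    apply Subtype.ext
    ext x
    exact DFunLike.congr_fun hab x
  exact IsKleinFour.not_isCyclic (isCyclic_of_injective _ hinj)

/-- By Wedderburn's little theorem, an associative `A` would be a finite field. -/
theorem not_isAssociativeAlg_of_memC {k A : Type*} [Field k] [Finite k] [NonUnitalNonAssocRing A]
    [Module k A] [IsScalarTower k A A] [SMulCommClass k A A] (hA : MemC k A) :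
    ¬ IsAssociativeAlg A := by
  intro hassoc
  obtain ⟨hdim, hdiv, ⟨e, he, -⟩, H, hH⟩ := hA
  have : Module.Finite k A := Module.finite_of_finrank_pos (by omega)
  have : Finite A := Module.finite_of_finite k
  have hnt := hdiv.1
  let R : Ring A :=
    { ‹NonUnitalNonAssocRing A› with
      one := e
      one_mul := fun x => (he x).1
      mul_one := fun x => (he x).2
      mul_assoc := fun a b c => hassoc a b c }
  have hnz : NoZeroDivisors A := ⟨by
    intro a b hab
    by_contra! h
    exact hdiv.mul_ne_zero h.1 h.2 hab⟩
  have hdom : IsDomain A := NoZeroDivisors.to_isDomain A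
  let F : Field A := (Finite.isDomain_to_isField A).toField
  let _ : Algebra k A := Algebra.ofModule (fun r x y => smul_mul_assoc r x y)
    (fun r x y => mul_smul_comm r x y)
  exact not_isKleinFour_of_field k A H hH

end FieldCase

/-! ### Linear maps out of `ℓ` prescribed on `1` and `s` -/

section LinearMaps

variable {k A : Type*} [Field k] [NonUnitalNonAssocRing A] [Module k A]

theorem eq_zero_of_add_self_eq_zero (h2 : (2 : k) ≠ 0) {v : A} (h : v + v = 0) : v = 0 := by
  rw [← two_smul k] at h
  exact (smul_eq_zero.1 h).resolve_left h2

variable {ℓ : Type*} [Field ℓ] [Algebra k ℓ]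

theorem IsSqrtGenerator.exists_linearMap {d : k} {s : ℓ} (hs : IsSqrtGenerator k ℓ d s)
    (a b : A) : ∃ ι : ℓ →ₗ[k] A, ι 1 = a ∧ ι s = b := by
  let f : (k × k) →ₗ[k] ℓ :=
    (Algebra.linearMap k ℓ).comp (LinearMap.fst k k k) +
      ((LinearMap.mulRight k s).comp (Algebra.linearMap k ℓ)).comp (LinearMap.snd k k k)
  have hf : ∀ p, f p = algebraMap k ℓ p.1 + algebraMap k ℓ p.2 * s := fun p => rfl
  have hbij : Function.Bijective f := by
    constructor
    · rw [← LinearMap.ker_eq_bot, LinearMap.ker_eq_bot']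
      rintro ⟨p, q⟩ h
      obtain ⟨rfl, rfl⟩ := hs.coords_eq_zero h
      rfl
    · intro x
      obtain ⟨p, q, rfl⟩ := hs.exists_coords x
      exact ⟨(p, q), rfl⟩
  let E := LinearEquiv.ofBijective f hbij
  have h1 : E.symm 1 = (1, 0) := by
    rw [LinearEquiv.symm_apply_eq, LinearEquiv.ofBijective_apply, hf]
    simp
  have h2 : E.symm s = (0, 1) := by
    rw [LinearEquiv.symm_apply_eq, LinearEquiv.ofBijective_apply, hf]
    simp
  refine ⟨((LinearMap.toSpanSingleton k A a).coprod (LinearMap.toSpanSingleton k A b)).comp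
    E.symm.toLinearMap, ?_, ?_⟩
  · simp [h1]
  · simp [h2]

theorem IsSqrtGenerator.linearMap_coords {d : k} {s : ℓ} (_ : IsSqrtGenerator k ℓ d s)
    (ι : ℓ →ₗ[k] A) (p q : k) :
    ι (algebraMap k ℓ p + algebraMap k ℓ q * s) = p • ι 1 + q • ι s := by
  rw [← map_smul, ← map_smul, ← map_add, Algebra.smul_def, Algebra.smul_def, mul_one]

end LinearMaps

/-! ### The right nucleus is a copy of `ℓ` -/

section Nucleus

variable {k A : Type*} [Field k] [NonUnitalNonAssocRing A] [Module k A] [IsScalarTower k A A]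
  [SMulCommClass k A A]

/-- The right nucleus as a subspace. -/
def rightNucleusSubmodule (k A : Type*) [Field k] [NonUnitalNonAssocRing A] [Module k A]
    [IsScalarTower k A A] [SMulCommClass k A A] : Submodule k A where
  carrier := rightNucleus A
  add_mem' {a b} ha hb x y := by rw [mul_add, mul_add, mul_add, ha, hb]
  zero_mem' x y := by simp
  smul_mem' r a ha x y := by rw [mul_smul_comm, mul_smul_comm, mul_smul_comm, ha]

theorem mul_mem_rightNucleus {z t : A} (hz : z ∈ rightNucleus A) (ht : t ∈ rightNucleus A) :
    z * t ∈ rightNucleus A := fun x y => by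
  rw [← ht, hz, ht, ht]

theorem unity_mem_rightNucleus {e : A} (he : IsUnity e) : e ∈ rightNucleus A := fun x y => by
  rw [(he _).2, (he _).2]

/-- Solve `mn = e`; both nuclearity of `m` and `nm = e` follow after cancelling `n` on the right. -/
theorem exists_inverse_mem_rightNucleus (hdiv : IsDivisionAlg A) {e : A} (he : IsUnity e) {n : A}
    (hn : n ∈ rightNucleus A) (hn0 : n ≠ 0) : ∃ m ∈ rightNucleus A, n * m = e := by
  obtain ⟨m, hm⟩ := (hdiv.2 n hn0).2.2 e
  simp only at hm
  have hinj := (hdiv.2 n hn0).2.1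
  refine ⟨m, fun x y => hinj ?_, hinj ?_⟩
  · simp only
    rw [hn, hn, hn, hm, (he _).2, (he _).2]
  · simp only
    rw [hn, hm, (he _).1, (he _).2]

/-- For non-zero `x`, the subspaces `xN` and `N` of a 4-dimensional space have dimension at least 3,
so they meet in some `xn ≠ 0`. Inverting `n` inside `N` gives `x ∈ N`, hence `N = A`. -/
theorem isAssociativeAlg_of_finrank_rightNucleus (hdiv : IsDivisionAlg A) {e : A} (he : IsUnity e)
    (hdim : Module.finrank k A = 4)
    (hN : 3 ≤ Module.finrank k (rightNucleusSubmodule k A)) : IsAssociativeAlg A := by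
  have hfin : Module.Finite k A := Module.finite_of_finrank_pos (by omega)
  suffices h : ∀ z : A, z ∈ rightNucleus A from fun x y z => h z x y
  intro x
  by_contra hx
  have hx0 : x ≠ 0 := by
    rintro rfl
    exact hx (rightNucleusSubmodule k A).zero_mem
  have hinj : Function.Injective (LinearMap.mulLeft k x) := (hdiv.2 x hx0).1.1
  have h1 := Submodule.finrank_sup_add_finrank_inf_eq
    ((rightNucleusSubmodule k A).map (LinearMap.mulLeft k x)) (rightNucleusSubmodule k A)
  have h2 := ((rightNucleusSubmodule k A).map (LinearMap.mulLeft k x) ⊔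
    rightNucleusSubmodule k A).finrank_le
  rw [← (Submodule.equivMapOfInjective _ hinj (rightNucleusSubmodule k A)).finrank_eq] at h1
  have h3 : (rightNucleusSubmodule k A).map (LinearMap.mulLeft k x) ⊓
      rightNucleusSubmodule k A ≠ ⊥ := by
    intro h
    rw [h, finrank_bot] at h1
    omega
  obtain ⟨m, ⟨⟨n, hn, rfl⟩, hm⟩, hm0⟩ := Submodule.exists_mem_ne_zero_of_ne_bot h3
  have hn0 : n ≠ 0 := by
    rintro rfl
    simp at hm0
  obtain ⟨n', hn', hnn⟩ := exists_inverse_mem_rightNucleus hdiv he hn hn0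
  apply hx
  have : x = (x * n) * n' := by rw [hn', hnn, (he _).2]
  rw [this]
  exact mul_mem_rightNucleus hm hn'

variable {ℓ : Type*} [Field ℓ] [Algebra k ℓ]

/-- `ι` identifies `ℓ` with the right nucleus of `A`. -/
structure IsNucleusEmbedding (ι : ℓ →ₗ[k] A) (e : A) : Prop where
  map_one : ι 1 = e
  map_mul : ∀ x y, ι (x * y) = ι x * ι y
  injective : Function.Injective ι
  range_eq : Set.range ι = rightNucleus A

/-- The nucleus has dimension at least 2 by the proper containment and less than 3 by
non-associativity. Spanned by `e` and one further element, it becomes `k(√D)` after completing the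
square; `D` is a non-square because `A` has no zero divisors, and over a finite field all
non-squares give the same extension. -/
theorem IsSqrtGenerator.exists_isNucleusEmbedding {d : k} {s : ℓ} (hs : IsSqrtGenerator k ℓ d s)
    [Finite k] (h2 : (2 : k) ≠ 0) (hA : MemC k A) :
    ∃ (e : A) (ι : ℓ →ₗ[k] A), IsUnity e ∧ IsNucleusEmbedding ι e := by
  have hnonassoc := not_isAssociativeAlg_of_memC hA
  obtain ⟨hdim, hdiv, ⟨e, he, hsub, hproper⟩, -⟩ := hA
  have hfin : Module.Finite k A := Module.finite_of_finrank_pos (by omega)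
  have hN : Module.finrank k (rightNucleusSubmodule k A) < 3 := by
    by_contra! h
    exact hnonassoc (isAssociativeAlg_of_finrank_rightNucleus hdiv he hdim h)
  have hnt := hdiv.1
  have he0 : e ≠ 0 := by
    rintro rfl
    obtain ⟨x, hx⟩ := exists_ne (0 : A)
    exact hx (by rw [← (he x).1, zero_mul])
  obtain ⟨z, hz, hzk⟩ := Set.not_subset.1 hproper
  have hindep : ∀ p q : k, p • e + q • z = 0 → p = 0 ∧ q = 0 := by
    intro p q h
    have hq : q = 0 := by
      by_contra hq
      apply hzk
      refine ⟨-(q⁻¹ * p), ?_⟩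
      have : z = q⁻¹ • ((p • e + q • z) - p • e) := by
        rw [add_sub_cancel_left, smul_smul, inv_mul_cancel₀ hq, one_smul]
      rw [this, h]
      module
    subst hq
    simpa [he0] using h
  have hspan : ∀ n ∈ rightNucleus A, ∃ p q : k, n = p • e + q • z := by
    have hli : LinearIndependent k ![e, z] := LinearIndependent.pair_iff.2 hindep
    have hle : Submodule.span k {e, z} ≤ rightNucleusSubmodule k A := by
      rw [Submodule.span_le]
      rintro x (rfl | rfl)
      · exact unity_mem_rightNucleus he
      · exact hz
    have hcard := finrank_span_eq_card hli
    rw [Matrix.range_cons, Matrix.range_cons, Matrix.range_empty, Set.union_empty,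
      Set.singleton_union, Fintype.card_fin] at hcard
    have heq := Submodule.eq_of_le_of_finrank_le hle (by omega)
    intro n hn
    have hn' : n ∈ Submodule.span k {e, z} := by rw [heq]; exact hn
    obtain ⟨p, q, h⟩ := Submodule.mem_span_pair.1 hn'
    exact ⟨p, q, h.symm⟩
  obtain ⟨p, q, hzz⟩ := hspan _ (mul_mem_rightNucleus hz hz)
  -- Completing the square in `z² = pe + qz`, so that `y² = De`.
  obtain ⟨y, hy⟩ : ∃ y, y = z - (q / 2) • e := ⟨_, rfl⟩
  obtain ⟨D, hD⟩ : ∃ D, D = p + q ^ 2 / 4 := ⟨_, rfl⟩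
  have h4 : (4 : k) ≠ 0 := by
    have : (4 : k) = 2 * 2 := by norm_num
    rw [this]; exact mul_ne_zero h2 h2
  have hyy : y * y = D • e := by
    rw [hy]
    simp only [mul_sub, sub_mul, hzz, mul_smul_comm, smul_mul_assoc, (he _).1, (he _).2, hD]
    match_scalars <;> field_simp <;> ring
  have hDsq : ¬ IsSquare D := by
    rintro ⟨t, rfl⟩
    have h0 : (y - t • e) * (y + t • e) = 0 := by
      simp only [mul_add, sub_mul, hyy, mul_smul_comm, smul_mul_assoc, (he _).1, (he _).2]
      module
    have h1 : y - t • e = 0 ∨ y + t • e = 0 := by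
      by_contra! h
      exact hdiv.mul_ne_zero h.1 h.2 h0
    rcases h1 with h1 | h1
    · have := hindep (-(q / 2) - t) 1 (by rw [← h1, hy]; module)
      exact one_ne_zero this.2
    · have := hindep (-(q / 2) + t) 1 (by rw [← h1, hy]; module)
      exact one_ne_zero this.2
  obtain ⟨r, hr⟩ := isSquare_div_of_not_isSquare h2 hDsq hs.not_isSquare
  have hd0 : d ≠ 0 := fun h => hs.not_isSquare (h ▸ IsSquare.zero)
  have hD' : D = r * r * d := by rw [← hr]; field_simp
  have hr0 : r ≠ 0 := by
    rintro rfl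
    exact hDsq ⟨0, by simpa using hD'⟩
  obtain ⟨ι, hι1, hιs⟩ := hs.exists_linearMap e (r⁻¹ • y)
  have hss : ι s * ι s = d • e := by
    rw [hιs, mul_smul_comm, smul_mul_assoc, hyy, hD', smul_smul, smul_smul]
    congr 1
    field_simp
  have hmemN : ∀ p q : k, p • e + q • z ∈ rightNucleus A := fun p q =>
    (rightNucleusSubmodule k A).add_mem
      ((rightNucleusSubmodule k A).smul_mem p (unity_mem_rightNucleus he))
      ((rightNucleusSubmodule k A).smul_mem q hz)
  refine ⟨e, ι, he, hι1, ?_, ?_, ?_⟩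
  · intro x x'
    obtain ⟨a, b, rfl⟩ := hs.exists_coords x
    obtain ⟨a', b', rfl⟩ := hs.exists_coords x'
    have h : (algebraMap k ℓ a + algebraMap k ℓ b * s) * (algebraMap k ℓ a' + algebraMap k ℓ b' * s)
        = algebraMap k ℓ (a * a' + b * b' * d) + algebraMap k ℓ (a * b' + b * a') * s := by
      simp only [map_add, map_mul, ← hs.mul_self]
      ring
    rw [h]
    simp only [hs.linearMap_coords, hι1, mul_add, add_mul, mul_smul_comm, smul_mul_assoc, (he _).1,
      (he _).2, hss]
    module
  · rw [← LinearMap.ker_eq_bot, LinearMap.ker_eq_bot']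
    intro x hx
    obtain ⟨a, b, rfl⟩ := hs.exists_coords x
    rw [hs.linearMap_coords, hι1, hιs, hy] at hx
    obtain ⟨h5, h6⟩ := hindep (a - b * r⁻¹ * (q / 2)) (b * r⁻¹) (by rw [← hx]; module)
    have hb : b = 0 := by simpa [hr0] using h6
    subst hb
    have ha : a = 0 := by simpa using h5
    simp [ha]
  · ext n
    constructor
    · rintro ⟨x, rfl⟩
      obtain ⟨a, b, rfl⟩ := hs.exists_coords x
      rw [hs.linearMap_coords, hι1, hιs, hy]
      convert hmemN (a - b * r⁻¹ * (q / 2)) (b * r⁻¹) using 1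
      module
    · intro hn
      obtain ⟨a, b, rfl⟩ := hspan n hn
      refine ⟨algebraMap k ℓ (a + b * (q / 2)) + algebraMap k ℓ (b * r) * s, ?_⟩
      rw [hs.linearMap_coords, hι1, hιs, hy]
      match_scalars <;> field_simp
      ring

end Nucleus

/-! ### Reconstruction of an algebra in `𝒞(k)` as some `A(ℓ,c)` -/

theorem IsKleinFour.exists_generators {G : Type*} [Group G] [IsKleinFour G] :
    ∃ a b : G, a ≠ 1 ∧ b ≠ 1 ∧ a ≠ b ∧ a * a = 1 ∧ b * b = 1 ∧ a * b = b * a := by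
  classical
  have := Nat.finite_of_card_ne_zero (α := G) (by rw [IsKleinFour.card_four]; norm_num)
  have := Fintype.ofFinite G
  have hcard : Fintype.card G = 4 := by rw [← Nat.card_eq_fintype_card, IsKleinFour.card_four]
  obtain ⟨a, ha⟩ : ∃ a : G, a ∉ ({1} : Finset G) := by
    by_contra! h
    have := Finset.card_le_card (fun x _ => h x : Finset.univ ⊆ ({1} : Finset G))
    rw [Finset.card_univ, hcard] at this
    simp at this
  obtain ⟨b, hb⟩ : ∃ b : G, b ∉ ({1, a} : Finset G) := by
    by_contra! h
    have := Finset.card_le_card (fun x _ => h x : Finset.univ ⊆ ({1, a} : Finset G))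
    rw [Finset.card_univ, hcard] at this
    have := this.trans Finset.card_le_two
    omega
  simp only [Finset.mem_singleton, Finset.mem_insert, not_or] at ha hb
  have hsq : ∀ x : G, x * x = 1 := IsKleinFour.mul_self
  refine ⟨a, b, ha, hb.1, fun h => hb.2 h.symm, hsq a, hsq b, ?_⟩
  have h := hsq (a * b)
  rw [mul_eq_one_iff_eq_inv, mul_inv_rev, inv_eq_of_mul_eq_one_right (hsq a),
    inv_eq_of_mul_eq_one_right (hsq b)] at h
  exact h

theorem IsoAlg.isDivisionAlg {k A B : Type*} [Field k] [NonUnitalNonAssocRing A] [Module k A]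
    [NonUnitalNonAssocRing B] [Module k B]
    [IsScalarTower k B B] [SMulCommClass k B B] [Module.Finite k B]
    (h : IsoAlg k A B) (hA : IsDivisionAlg A) : IsDivisionAlg B := by
  obtain ⟨φ, hφ⟩ := h.symm
  have := hA.1
  have := φ.toEquiv.nontrivial
  refine isDivisionAlg_of_mul_ne_zero k fun a b ha hb hab => ?_
  refine hA.mul_ne_zero (a := φ a) (b := φ b) (by simpa) (by simpa) ?_
  rw [← hφ, hab, map_zero]

section Reconstruction

variable {k A ℓ : Type*} [Field k] [NonUnitalNonAssocRing A] [Module k A] [IsScalarTower k A A]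
  [SMulCommClass k A A] [Field ℓ] [Algebra k ℓ] {ι : ℓ →ₗ[k] A} {e : A} {d : k} {s : ℓ}

theorem IsNucleusEmbedding.mem (hι : IsNucleusEmbedding ι e) (x : ℓ) : ι x ∈ rightNucleus A := by
  rw [← hι.range_eq]
  exact ⟨x, rfl⟩

/-- An automorphism preserves the right nucleus and sends `ι s` to a square root of `d` there, which
can only be `±ι s`. -/
theorem IsNucleusEmbedding.aut_apply (hι : IsNucleusEmbedding ι e) (he : IsUnity e)
    (hs : IsSqrtGenerator k ℓ d s) {φ : A ≃ₗ[k] A} (hφ : ∀ x y, φ (x * y) = φ x * φ y) :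
    (∀ x, φ (ι x) = ι x) ∨ ∀ x, φ (ι x) = ι (conj k ℓ x) := by
  have hφe : φ (ι 1) = ι 1 := by
    rw [hι.map_one]
    have h := congrArg φ (he (φ.symm e)).1
    rw [hφ, φ.apply_symm_apply, (he _).2] at h
    exact h
  obtain ⟨y, hy⟩ : φ (ι s) ∈ Set.range ι := by
    rw [hι.range_eq]
    exact (mul_mem_rightNucleus_iff φ.toEquiv hφ _).2 (hι.mem s)
  have hyy : y * y = s * s := by
    apply hι.injective
    rw [hι.map_mul, hy, ← hφ, ← hι.map_mul, hs.mul_self, Algebra.algebraMap_eq_smul_one, map_smul,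
      map_smul, hφe]
  rcases mul_self_eq_mul_self_iff.1 hyy with rfl | rfl
  · left
    intro x
    obtain ⟨p, q, rfl⟩ := hs.exists_coords x
    rw [hs.linearMap_coords, map_add, map_smul, map_smul, hφe, ← hy]
  · right
    intro x
    obtain ⟨p, q, rfl⟩ := hs.exists_coords x
    have h : algebraMap k ℓ p - algebraMap k ℓ q * s
        = algebraMap k ℓ p + algebraMap k ℓ (-q) * s := by
      rw [map_neg]; ring
    rw [hs.conj_coords, h, hs.linearMap_coords, hs.linearMap_coords, map_add, map_smul, map_smul,
      hφe, ← hy, map_neg, smul_neg, neg_smul]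

/-- The map `A(ℓ,c) → A`, `(x,y) ↦ ι x + j (ι y)`. -/
noncomputable def fromAlgA (ι : ℓ →ₗ[k] A) (j : A) (c : k × k × k) : AlgA ℓ c →ₗ[k] A :=
  (ι.coprod ((LinearMap.mulLeft k j).comp ι)).comp (AlgA.toProd k ℓ c).toLinearMap

theorem fromAlgA_apply (ι : ℓ →ₗ[k] A) (j : A) (c : k × k × k) (a : AlgA ℓ c) :
    fromAlgA ι j c a = ι a.fst + j * ι a.snd := by
  simp [fromAlgA, AlgA.toProd]

/-- The subspaces `ιℓ` and `jιℓ` lie in the eigenspaces of `α` for `1` and `-1`, so their sum is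
direct; both have dimension 2. -/
theorem IsNucleusEmbedding.fromAlgA_bijective (hι : IsNucleusEmbedding ι e) (h2 : (2 : k) ≠ 0)
    (hdiv : IsDivisionAlg A) (hdim : Module.finrank k A = 4) (hℓ : Module.finrank k ℓ = 2)
    {α : A ≃ₗ[k] A} (hα : ∀ x y, α (x * y) = α x * α y) (hαι : ∀ x, α (ι x) = ι x) {j : A}
    (hj : j ≠ 0) (hαj : α j = -j) (c : k × k × k) : Function.Bijective (fromAlgA ι j c) := by
  have hfin : Module.Finite k A := Module.finite_of_finrank_pos (by omega)
  have hfin' : Module.Finite k (AlgA ℓ c) :=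
    Module.finite_of_finrank_pos (by rw [AlgA.finrank_eq hℓ]; norm_num)
  have hinj : Function.Injective (fromAlgA ι j c) := by
    rw [← LinearMap.ker_eq_bot, LinearMap.ker_eq_bot']
    intro a ha
    rw [fromAlgA_apply] at ha
    have ha' := congrArg α ha
    rw [map_add, hα, hαι, hαι, hαj, neg_mul, map_zero] at ha'
    have h1 : ι a.fst = 0 := by
      apply eq_zero_of_add_self_eq_zero h2
      calc ι a.fst + ι a.fst = (ι a.fst + j * ι a.snd) + (ι a.fst + -(j * ι a.snd)) := by abel
        _ = 0 := by rw [ha, ha', add_zero]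
    rw [h1, zero_add] at ha
    have h3 : ι a.snd = 0 := by
      by_contra h
      exact hdiv.mul_ne_zero hj h ha
    exact AlgA.ext (hι.injective (by rw [h1, AlgA.zero_fst, map_zero]))
      (hι.injective (by rw [h3, AlgA.zero_snd, map_zero]))
  exact ⟨hinj, (LinearMap.injective_iff_surjective_of_finrank_eq_finrank
    (by rw [hdim, AlgA.finrank_eq hℓ])).1 hinj⟩

/-- The data from which `A(ℓ,c)` is reconstructed: commuting automorphisms acting on the right
nucleus trivially and by conjugation, and a common eigenvector `j` for `-1` and `1`. -/
theorem IsNucleusEmbedding.exists_eigenvector (hι : IsNucleusEmbedding ι e) (he : IsUnity e)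
    (hs : IsSqrtGenerator k ℓ d s) (h2 : (2 : k) ≠ 0) (hℓ : Module.finrank k ℓ = 2)
    (hA : MemC k A) : ∃ (α β : A ≃ₗ[k] A) (j : A), (∀ x y, α (x * y) = α x * α y) ∧
      (∀ x y, β (x * y) = β x * β y) ∧ (∀ x, α (ι x) = ι x) ∧
      (∀ x, β (ι x) = ι (conj k ℓ x)) ∧ j ≠ 0 ∧ α j = -j ∧ β j = j := by
  obtain ⟨hdim, hdiv, -, H, hH⟩ := hA
  have hneg : ∀ v : A, v = -v → v = 0 := fun v hv =>
    eq_zero_of_add_self_eq_zero h2 (by nth_rewrite 2 [hv]; exact add_neg_cancel v)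
  obtain ⟨α, β, hα, hβ, hα1, hne, hαα, hββ, hαβ, hαι⟩ : ∃ α β : A ≃ₗ[k] A,
      (∀ x y, α (x * y) = α x * α y) ∧ (∀ x y, β (x * y) = β x * β y) ∧ α ≠ 1 ∧ (β ≠ 1 ∧ β ≠ α) ∧
      (∀ x, α (α x) = x) ∧ (∀ x, β (β x) = x) ∧ (∀ x, α (β x) = β (α x)) ∧
      (∀ x, α (ι x) = ι x) := by
    obtain ⟨a, b, ha1, hb1, hab, haa, hbb, hcomm⟩ := IsKleinFour.exists_generators (G := H)
    have coe_inj : ∀ x y : H, (x : autGroup k A).1 = (y : autGroup k A).1 → x = y :=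
      fun x y h => Subtype.ext (Subtype.ext h)
    have hsq : ∀ c : H, c * c = 1 → ∀ x, (c : autGroup k A).1 ((c : autGroup k A).1 x) = x := by
      intro c hc x
      exact DFunLike.congr_fun (congrArg (fun t : H => (t : autGroup k A).1) hc) x
    have hcomm' : ∀ c c' : H, c * c' = c' * c → ∀ x, (c : autGroup k A).1
        ((c' : autGroup k A).1 x) = (c' : autGroup k A).1 ((c : autGroup k A).1 x) := by
      intro c c' hc x
      exact DFunLike.congr_fun (congrArg (fun t : H => (t : autGroup k A).1) hc) x
    have main : ∀ c c' : H, c ≠ 1 → c' ≠ 1 → c' ≠ c → c * c = 1 → c' * c' = 1 → c * c' = c' * c →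
        (∀ x, (c : autGroup k A).1 (ι x) = ι x) → ∃ α β : A ≃ₗ[k] A,
      (∀ x y, α (x * y) = α x * α y) ∧ (∀ x y, β (x * y) = β x * β y) ∧ α ≠ 1 ∧ (β ≠ 1 ∧ β ≠ α) ∧
      (∀ x, α (α x) = x) ∧ (∀ x, β (β x) = x) ∧ (∀ x, α (β x) = β (α x)) ∧
      (∀ x, α (ι x) = ι x) := by
      intro c c' h1 h1' h3 h4 h4' h5 h6
      exact ⟨_, _, (c : autGroup k A).2, (c' : autGroup k A).2, fun h => h1 (coe_inj _ _ h),
        ⟨fun h => h1' (coe_inj _ _ h), fun h => h3 (coe_inj _ _ h)⟩, hsq c h4, hsq c' h4',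
        hcomm' c c' h5, h6⟩
    rcases hι.aut_apply he hs (a : autGroup k A).2 with h | h
    · exact main a b ha1 hb1 hab.symm haa hbb hcomm h
    rcases hι.aut_apply he hs (b : autGroup k A).2 with h' | h'
    · exact main b a hb1 ha1 hab hbb haa hcomm.symm h'
    -- If both generators conjugate the nucleus, their product fixes it.
    refine main (a * b) a ?_ ha1 ?_ ?_ haa ?_ ?_
    · intro h1
      apply hab
      rw [← mul_one a, ← hbb, ← mul_assoc, h1, one_mul]
    · intro h1
      exact hb1 (by simpa using h1.symm)
    · rw [mul_assoc, ← mul_assoc b, ← hcomm, mul_assoc a, hbb, mul_one, haa]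
    · rw [mul_assoc, ← hcomm]
    · intro x
      change (a : autGroup k A).1 ((b : autGroup k A).1 (ι x)) = ι x
      rw [h', h, hs.conj_conj]
  obtain ⟨v, hv⟩ : ∃ v, α v ≠ v := by
    by_contra! h
    exact hα1 (LinearEquiv.ext h)
  obtain ⟨j₀, hj₀, hαj₀⟩ : ∃ j₀ : A, j₀ ≠ 0 ∧ α j₀ = -j₀ :=
    ⟨α v - v, sub_ne_zero.2 hv, by rw [map_sub, hαα]; abel⟩
  -- `β` commutes with `α`, so it acts as an involution on the `-1` eigenspace of `α` and has an
  -- eigenvector there.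
  obtain ⟨j, hj, hαj, hβj⟩ : ∃ j : A, j ≠ 0 ∧ α j = -j ∧ (β j = j ∨ β j = -j) := by
    by_cases h : j₀ + β j₀ = 0
    · exact ⟨j₀, hj₀, hαj₀, Or.inr (eq_neg_of_add_eq_zero_right h)⟩
    · exact ⟨j₀ + β j₀, h, by rw [map_add, hαβ, hαj₀, map_neg]; abel,
        Or.inl (by rw [map_add, hββ, add_comm])⟩
  rcases hι.aut_apply he hs hβ with hβι | hβι
  -- If `β` also fixed the nucleus, its value `±j` at `j` would determine it on `A = ιℓ ⊕ jιℓ`,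
  -- forcing `β = 1` or `β = α`. The triple `0` below is arbitrary: the linear bijection does not
  -- depend on it.
  · exfalso
    have hsurj := (hι.fromAlgA_bijective h2 hdiv hdim hℓ hα hαι hj hαj 0).2
    rcases hβj with hβj | hβj
    · apply hne.1
      ext x
      obtain ⟨a, rfl⟩ := hsurj x
      rw [fromAlgA_apply, map_add, hβ, hβι, hβι, hβj]
      rfl
    · apply hne.2
      ext x
      obtain ⟨a, rfl⟩ := hsurj x
      rw [fromAlgA_apply, map_add, map_add, hβ, hα, hβι, hβι, hβj, hαι, hαι, hαj]
  · rcases hβj with hβj | hβj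
    · exact ⟨α, β, j, hα, hβ, hαι, hβι, hj, hαj, hβj⟩
    -- Since `β` negates both `j` and `ι s`, it fixes `jι(s)`, which stays in the `-1` eigenspace of
    -- `α`.
    · refine ⟨α, β, j * ι s, hα, hβ, hαι, hβι, ?_, ?_, ?_⟩
      · refine hdiv.mul_ne_zero hj fun h => hs.ne_zero (hι.injective ?_)
        rw [h, map_zero]
      · rw [hα, hαj, hαι, neg_mul]
      · rw [hβ, hβj, hβι, hs.conj_eq, map_neg, neg_mul_neg]

theorem IsSqrtGenerator.exists_of_conj_eq_neg (hs : IsSqrtGenerator k ℓ d s) (h2 : (2 : k) ≠ 0)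
    {x : ℓ} (hx : conj k ℓ x = -x) : ∃ q : k, x = algebraMap k ℓ q * s := by
  obtain ⟨p, q, rfl⟩ := hs.exists_coords x
  rw [hs.conj_coords] at hx
  have : algebraMap k ℓ (2 * p) + algebraMap k ℓ 0 * s = 0 := by
    simp only [map_mul, map_ofNat, map_zero]
    linear_combination hx
  have hp : p = 0 := by simpa [h2] using (hs.coords_eq_zero this).1
  exact ⟨q, by simp [hp]⟩

/-- By nuclearity of `ιℓ`, the product on `ιℓ ⊕ jιℓ` is determined by `ι(x)j` and `(jι(y))j`. The
grading by `α` places them in `jιℓ` and `ιℓ`; equivariance under `β` leaves one scalar for each of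
`ι(s)j`, `j²` and `(jι(s))j`. These three scalars encode `c`. -/
theorem MemC.exists_isoAlg [Finite k] (hs : IsSqrtGenerator k ℓ d s) (h2 : (2 : k) ≠ 0)
    (hℓ : Module.finrank k ℓ = 2) (hA : MemC k A) : ∃ c : k × k × k, IsoAlg k A (AlgA ℓ c) := by
  obtain ⟨e, ι, he, hι⟩ := hs.exists_isNucleusEmbedding h2 hA
  obtain ⟨α, β, j, hα, hβ, hαι, hβι, hj, hαj, hβj⟩ := hι.exists_eigenvector he hs h2 hℓ hA
  have hdiv := hA.division
  have hbij := hι.fromAlgA_bijective h2 hdiv hA.finrank_eq hℓ hα hαι hj hαj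
  have hplus : ∀ v, α v = v → ∃ x, v = ι x := by
    intro v hv
    obtain ⟨a, rfl⟩ := (hbij 0).2 v
    rw [fromAlgA_apply] at hv ⊢
    rw [map_add, hα, hαι, hαι, hαj, neg_mul] at hv
    have : j * ι a.snd = 0 := by
      apply eq_zero_of_add_self_eq_zero h2
      rw [← neg_eq_iff_add_eq_zero]
      exact add_left_cancel hv
    exact ⟨a.fst, by rw [this, add_zero]⟩
  have hminus : ∀ v, α v = -v → ∃ y, v = j * ι y := by
    intro v hv
    obtain ⟨a, rfl⟩ := (hbij 0).2 v
    rw [fromAlgA_apply] at hv ⊢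
    rw [map_add, hα, hαι, hαι, hαj, neg_mul, neg_add] at hv
    have : ι a.fst = 0 := by
      apply eq_zero_of_add_self_eq_zero h2
      rw [← eq_neg_iff_add_eq_zero]
      exact add_right_cancel hv
    exact ⟨a.snd, by rw [this, zero_add]⟩
  have hjinj : ∀ x y, j * ι x = j * ι y → x = y := fun x y h =>
    hι.injective ((hdiv.2 j hj).1.1 h)
  obtain ⟨l, hl⟩ : ∃ l : k, ι s * j = j * ι (algebraMap k ℓ l * s) := by
    obtain ⟨y, hy⟩ := hminus (ι s * j) (by rw [hα, hαι, hαj, mul_neg])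
    obtain ⟨q, rfl⟩ := hs.exists_of_conj_eq_neg h2 (x := y) (hjinj _ _ (by
      have h := congrArg β hy
      rw [hβ, hβ, hβι, hβι, hβj, hs.conj_eq, map_neg, neg_mul, hy] at h
      rw [← h, map_neg, mul_neg]))
    exact ⟨q, hy⟩
  obtain ⟨m, hm⟩ : ∃ m : k, j * j = ι (algebraMap k ℓ m) := by
    obtain ⟨x, hx⟩ := hplus (j * j) (by rw [hα, hαj, neg_mul_neg])
    obtain ⟨q, rfl⟩ := hs.exists_of_conj_eq h2 (x := x) (hι.injective (by
      rw [← hβι, ← hx, hβ, hβj]))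
    exact ⟨q, hx⟩
  obtain ⟨n, hn⟩ : ∃ n : k, (j * ι s) * j = ι (algebraMap k ℓ n * s) := by
    obtain ⟨x, hx⟩ := hplus ((j * ι s) * j) (by rw [hα, hα, hαι, hαj, neg_mul, neg_mul_neg])
    obtain ⟨q, rfl⟩ := hs.exists_of_conj_eq_neg h2 (x := x) (hι.injective (by
      rw [← hβι, ← hx, hβ, hβ, hβι, hβj, hs.conj_eq, map_neg, map_neg, ← hx, mul_neg, neg_mul]))
    exact ⟨q, hx⟩
  -- Chosen so that `g` is `1 ↦ 1`, `s ↦ ls` and `f` is `1 ↦ m`, `s ↦ ns`.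
  obtain ⟨c, hc1, hc2, hc3⟩ : ∃ c : k × k × k, 1 - 2 * c.1 = l ∧ c.2.1 + c.2.2 = m ∧
      c.2.1 - c.2.2 = n :=
    ⟨((1 - l) / 2, (m + n) / 2, (m - n) / 2), by field_simp; ring, by field_simp; ring,
      by field_simp; ring⟩
  have hg : ∀ x, ι x * j =
      j * ι (algebraMap k ℓ (1 - c.1) * x + algebraMap k ℓ c.1 * conj k ℓ x) := by
    intro x
    obtain ⟨p, q, rfl⟩ := hs.exists_coords x
    have h : algebraMap k ℓ (1 - c.1) * (algebraMap k ℓ p + algebraMap k ℓ q * s) +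
        algebraMap k ℓ c.1 * conj k ℓ (algebraMap k ℓ p + algebraMap k ℓ q * s) =
        p • 1 + q • (algebraMap k ℓ l * s) := by
      rw [hs.conj_coords, ← hc1]
      simp only [map_sub, map_one, map_mul, map_ofNat, Algebra.smul_def]
      ring
    rw [h, hs.linearMap_coords, map_add, map_smul, map_smul, mul_add, mul_smul_comm,
      mul_smul_comm, ← hl, add_mul, smul_mul_assoc, smul_mul_assoc, hι.map_one, (he j).1, (he j).2]
  have hf : ∀ y, (j * ι y) * j =
      ι (algebraMap k ℓ c.2.1 * y + algebraMap k ℓ c.2.2 * conj k ℓ y) := by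
    intro x
    obtain ⟨p, q, rfl⟩ := hs.exists_coords x
    have h : algebraMap k ℓ c.2.1 * (algebraMap k ℓ p + algebraMap k ℓ q * s) +
        algebraMap k ℓ c.2.2 * conj k ℓ (algebraMap k ℓ p + algebraMap k ℓ q * s) =
        p • algebraMap k ℓ m + q • (algebraMap k ℓ n * s) := by
      rw [hs.conj_coords, ← hc2, ← hc3]
      simp only [map_sub, map_add, Algebra.smul_def]
      ring
    rw [h, hs.linearMap_coords, map_add, map_smul, map_smul, mul_add, mul_smul_comm,
      mul_smul_comm, ← hm, ← hn, add_mul, smul_mul_assoc, smul_mul_assoc, hι.map_one, (he j).2]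
  refine ⟨c, IsoAlg.symm ⟨LinearEquiv.ofBijective (fromAlgA ι j c) (hbij c), fun a b => ?_⟩⟩
  simp only [LinearEquiv.ofBijective_apply, fromAlgA_apply, AlgA.mul_fst, AlgA.mul_snd]
  have hN := hι.mem
  have hga := hg a.fst
  have hfa := hf a.snd
  generalize algebraMap k ℓ (1 - c.1) * a.fst + algebraMap k ℓ c.1 * conj k ℓ a.fst = x at hga ⊢
  generalize algebraMap k ℓ c.2.1 * a.snd + algebraMap k ℓ c.2.2 * conj k ℓ a.snd = y at hfa ⊢
  simp only [map_add, hι.map_mul, mul_add, add_mul]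
  -- Nuclearity moves the brackets: `ι(x)(jι(z)) = (ι(x)j)ι(z)`, and likewise with `jι(y)` in place
  -- of `ι(x)`.
  rw [← hN b.snd (ι a.fst) j, ← hN b.snd (j * ι a.snd) j, hga, hfa, hN b.snd j, hN b.fst j]
  abel

end Reconstruction

/-! ### Transversal and classification -/

theorem sqAbs_one {k : Type*} [Field k] : sqAbs (1 : k) = 1 := by
  rw [sqAbs, if_pos IsSquare.one]

section Classification

variable {k ℓ : Type*} [Field k] [Finite k] [Field ℓ] [Algebra k ℓ] {d : k} {s : ℓ}

namespace IsSqrtGenerator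

theorem admissibleTriplesN_eq (hs : IsSqrtGenerator k ℓ d s) (h2 : (2 : k) ≠ 0)
    (hℓ : Module.finrank k ℓ = 2) : admissibleTriplesN k ℓ =
      {c : k × k × k | (1 - c.1) * c.2.1 ≠ 0 ∧ ¬ IsSquare (1 - 2 * c.1) ∧
        c.2.2 = -c.1 * sqAbs c.2.1 / sqAbs (1 - c.1)} := by
  ext c
  simp only [admissibleTriplesN, admissibleTriples, Set.mem_ofPred_eq]
  constructor
  · rintro ⟨h, -⟩
    exact (hs.anisotropicFun_qFun_iff_not_isSquare h2 c).1 h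
  · intro h
    have h' := (hs.anisotropicFun_qFun_iff_not_isSquare h2 c).2 h
    refine ⟨h', AlgA.memC_of_anisotropicFun hs h2 hℓ h',
      AlgA.not_isAssociativeAlg hs h2 (fun h1 => h.1 ?_) h.2.1⟩
    rw [h1]; ring

theorem isTransversalOf_tripleTransversal (hs : IsSqrtGenerator k ℓ d s) (h2 : (2 : k) ≠ 0)
    (hℓ : Module.finrank k ℓ = 2) :
    IsTransversalOf (ellEquiv k ℓ) (admissibleTriplesN k ℓ) (tripleTransversal k) := by
  rw [hs.admissibleTriplesN_eq h2 hℓ]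
  constructor
  · rintro _ ⟨c₁, h1, hsq, rfl⟩
    refine ⟨?_, hsq, ?_⟩
    · simpa using sub_ne_zero.2 h1.symm
    · simp [sqAbs_one]
  · rintro ⟨c₁, c₂, c₃⟩ ⟨h1, hsq, h3⟩
    simp only at h1 hsq h3
    obtain ⟨h1', hc2⟩ := mul_ne_zero_iff.1 h1
    -- Scaling by a square root of `c₂`, whose norm is `|c₂|`, normalizes `c₂` to 1 and turns `c₃`
    -- into `-c₁/|1-c₁|`.
    obtain ⟨a, ha, ha'⟩ := hs.exists_sq_eq h2 c₂
    have ha0 : a ≠ 0 := by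
      rintro rfl
      exact hc2 ((map_eq_zero (algebraMap k ℓ)).1 (by rw [← ha, zero_pow two_ne_zero]))
    have hac : algebraMap k ℓ (sqAbs c₂) ≠ 0 := by
      simpa using sqAbs_ne_zero hc2
    refine ⟨(c₁, 1, -c₁ / sqAbs (1 - c₁)), ⟨⟨c₁, fun h => h1' (by rw [h]; ring), hsq, rfl⟩,
      ⟨a, ha0, rfl, ?_, ?_⟩⟩, ?_⟩
    · simp only
      rw [← ha, map_one, div_self (pow_ne_zero 2 ha0)]
    · simp only
      rw [ha', h3, ← map_div₀]
      congr 1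
      have := sqAbs_ne_zero hc2
      field_simp
    · rintro _ ⟨⟨t₁, -, -, rfl⟩, ⟨b, -, hb, -⟩⟩
      simp only at hb
      rw [hb]

theorem classifiesC_tripleTransversal {k : Type u} {ℓ : Type v} [Field k] [Finite k] [Field ℓ]
    [Algebra k ℓ] {d : k} {s : ℓ} (hs : IsSqrtGenerator k ℓ d s) (h2 : (2 : k) ≠ 0)
    (hℓ : Module.finrank k ℓ = 2) : ClassifiesC.{u, v, w} k ℓ (tripleTransversal k) where
  mem c hc := ((hs.isTransversalOf_tripleTransversal h2 hℓ).1 hc).2.1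
  exhaustive A _ _ _ _ hA := by
    obtain ⟨c, hc⟩ := hA.exists_isoAlg hs h2 hℓ
    have hfin : Module.Finite k (AlgA ℓ c) :=
      Module.finite_of_finrank_pos (by rw [AlgA.finrank_eq hℓ]; norm_num)
    have hani := AlgA.anisotropicFun_of_isDivisionAlg (hc.isDivisionAlg hA.division)
    have hmem : c ∈ admissibleTriplesN k ℓ := by
      rw [hs.admissibleTriplesN_eq h2 hℓ]
      exact (hs.anisotropicFun_qFun_iff_not_isSquare h2 c).1 hani
    obtain ⟨t, ⟨ht, hct⟩, -⟩ := (hs.isTransversalOf_tripleTransversal h2 hℓ).2 c hmem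
    exact ⟨t, ht, hc.trans (AlgA.isoAlg_of_ellEquiv hct)⟩
  irredundant := by
    rintro _ ⟨c₁, h1, hsq, rfl⟩ _ ⟨d₁, h1', hsq', rfl⟩ hiso
    have := AlgA.fst_eq_of_isoAlg hs h2 h1 hsq h1' hsq' hiso
    simp only at this
    rw [this]

end IsSqrtGenerator
end Classification

theorem corollary5p13 (k : Type u) (ℓ : Type v) [Field k] [Finite k]
    (hk : Odd (Nat.card k)) [Field ℓ] [Algebra k ℓ] (hℓ : Module.finrank k ℓ = 2) :
    admissiblePairs k ℓ = {ab : k × k | ab.1 = ab.2 ∧ ¬ IsSquare (1 - ab.1 ^ 2)} ∧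
    admissibleTriplesN k ℓ =
      {c : k × k × k | (1 - c.1) * c.2.1 ≠ 0 ∧ ¬ IsSquare (1 - 2 * c.1) ∧
        c.2.2 = -c.1 * sqAbs c.2.1 / sqAbs (1 - c.1)} ∧
    IsTransversalOf (ellEquiv k ℓ) (admissibleTriplesN k ℓ) (tripleTransversal k) ∧
    ClassifiesC.{u, v, w} k ℓ (tripleTransversal k) ∧
    ∀ (A : Type w) [NonUnitalNonAssocRing A] [Module k A] [IsScalarTower k A A]
      [SMulCommClass k A A], MemC k A → MemN k A := by
  obtain ⟨d, s, hs⟩ := exists_isSqrtGenerator hk hℓ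
  have h2 := two_ne_zero_of_odd_card hk
  refine ⟨?_, hs.admissibleTriplesN_eq h2 hℓ, hs.isTransversalOf_tripleTransversal h2 hℓ,
    hs.classifiesC_tripleTransversal h2 hℓ, fun A _ _ _ _ hA =>
      ⟨hA, not_isAssociativeAlg_of_memC hA⟩⟩
  ext ⟨a, b⟩
  exact hs.anisotropicFun_hFun_iff_not_isSquare h2 a b
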